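/- Let $H$ be a separable real Hilbert space and let $f\colon H\to\mathbb{C}$ be a continuous positive definite function with $f(0)=1$. (Positive definite means $\sum_{i,j}\overline{c_i}c_j f(\xi_j-\xi_i)\ge 0$ for all finite families $\xi_i\in H$, $c_i\in\mathbb{C}$.) For a probability space $(X,m)$ let $\mathrm{Aut}(X,m)$ be the group of $m$-preserving automorphisms of $X$ (bimeasurable bijections, identified if they agree $m$-a.e.) with the weak topology, i.e. the topology in which $\theta_i\to\theta$ iff $m(\theta_iA\,\triangle\,\theta A)\to 0$ for every measurable $A\subset X$. Call a group $\mathcal{G}$ of bounded invertible operators on $H$ a *uniformly bounded symmetry group of $f$* if $\sup_{u\in\mathcal{G}}\|u\|<\infty$ and $f(u\xi)=f(\xi)$ for all $u\in\mathcal{G}$, $\xi\in H$; equip $\mathcal{G}$ with the strong operator topology. Then there exist a compact metrizable space $X$ and a Borel probability measure $m$ on $X$ with the following properties. 1. There are a bounded linear operator $T\colon H\to L^2(X,m;\mathbb{R})$ and a measurable function $\varphi\colon X\to(0,\infty)$ such that $$f(\xi)=\int_X e^{i\varphi(x)[T\xi](x)}\,dm(x),\qquad \xi\in H. \tag{$*$}$$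 2. For every uniformly bounded symmetry group $\mathcal{G}$ of $f$, the pair $(T,\varphi)$ satisfying $(*)$ can be chosen (depending on $\mathcal{G}$) such that there is a continuous homomorphism $\beta\colon\mathcal{G}\to\mathrm{Aut}(X,m)$ with $$[T(u\xi)](x)=[T\xi](\beta(u)^{-1}x),\qquad \varphi(\beta(u)x)=\varphi(x)\qquad\text{for all }u\in\mathcal{G},\ \xi\in H\text{ and }m\text{-a.e. }x\in X. \tag{$**$}$$ 3. Suppose that $f$ generates a neighbourhood basis of $0$, i.e. every neighbourhood $V$ of $0$ in $H$ contains $f^{-1}(O)$ for some open $O\subset\mathbb{C}$ with $f(0)\in O$. Then there is a single pair $(T,\varphi)$ satisfying $(*)$ such that $T$ is a linear homeomorphism onto its range and such that for every uniformly bounded symmetry group $\mathcal{G}$ of $f$ there is a continuous homomorphism $\beta\colon\mathcal{G}\to\mathrm{Aut}(X,m)$ with $(**)$. -/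

import Mathlib

open MeasureTheory Topology Filter
open scoped ComplexOrder

noncomputable section

/-- Normalized continuous positive definite functions `f : H → ℂ` on (the additive group of) `H`,
that is, the class `𝒫(H)`. -/
structure IsNormalizedPosDef {H : Type*} [AddGroup H] [TopologicalSpace H] (f : H → ℂ) : Prop where
  continuous : Continuous f
  map_zero : f 0 = 1
  posDef : ∀ (n : ℕ) (ξ : Fin n → H) (c : Fin n → ℂ),
    0 ≤ ∑ i, ∑ j, (starRingEnd ℂ) (c i) * c j * f (ξ j - ξ i)

/-- `f` generates a neighbourhood basis of `0`: every neighbourhood of `0` contains a set `f⁻¹(O)`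
with `O ⊆ ℂ` open and `0 ∈ f⁻¹(O)`. -/
def GeneratesNhdsZero {H : Type*} [Zero H] [TopologicalSpace H] (f : H → ℂ) : Prop :=
  ∀ V ∈ 𝓝 (0 : H), ∃ O : Set ℂ, IsOpen O ∧ f 0 ∈ O ∧ f ⁻¹' O ⊆ V

section Aut

variable {X : Type*} [MeasurableSpace X]

/-- Measurable bijections of `X` with measurable inverse which preserve `m`. -/
def MPEquiv (m : Measure X) : Type _ := {t : X ≃ᵐ X // MeasurePreserving t m m}

namespace MPEquiv

variable {m : Measure X}

/-- Composition as multiplication: `(s * t) x = s (t x)`. -/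
instance : Group (MPEquiv m) where
  mul s t := ⟨t.1.trans s.1, s.2.comp t.2⟩
  one := ⟨MeasurableEquiv.refl X, MeasurePreserving.id m⟩
  inv t := ⟨t.1.symm, t.2.symm t.1⟩
  mul_assoc _ _ _ := rfl
  one_mul _ := rfl
  mul_one _ := rfl
  inv_mul_cancel t := Subtype.ext (MeasurableEquiv.self_trans_symm t.1)

/-- The weak topology: the one generated by the balls `{t | m (t A ∆ s A) < ε}` with `A`
measurable, `s` an `m`-preserving automorphism and `ε > 0`. -/
instance : TopologicalSpace (MPEquiv m) :=
  TopologicalSpace.generateFrom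
    {W | ∃ (s : MPEquiv m) (A : Set X) (ε : ENNReal), MeasurableSet A ∧ 0 < ε ∧
      W = {t : MPEquiv m | m (symmDiff (t.1 '' A) (s.1 '' A)) < ε}}

/-- The automorphisms which agree with the identity almost everywhere. -/
def aeTrivial (m : Measure X) : Subgroup (MPEquiv m) where
  carrier := {t | ∀ᵐ x ∂m, t.1 x = x}
  mul_mem' := by
    intro s t hs ht
    have hs' : ∀ᵐ x ∂m, s.1 x = x := hs
    have ht' : ∀ᵐ x ∂m, t.1 x = x := ht
    change ∀ᵐ x ∂m, s.1 (t.1 x) = x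
    filter_upwards [ht', hs'] with x h1 h2
    rw [h1, h2]
  one_mem' := by
    change ∀ᵐ x ∂m, x = x
    exact Eventually.of_forall fun _ => rfl
  inv_mem' := by
    intro t ht
    have ht' : ∀ᵐ x ∂m, t.1 x = x := ht
    change ∀ᵐ x ∂m, t.1.symm x = x
    filter_upwards [ht'] with x hx
    rw [MeasurableEquiv.symm_apply_eq, hx]

instance : (aeTrivial m).Normal where
  conj_mem := by
    intro n hn g
    have h : ∀ᵐ x ∂m, n.1 (g.1.symm x) = g.1.symm x :=
      (g.2.symm g.1).quasiMeasurePreserving.ae hn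
    change ∀ᵐ x ∂m, g.1 (n.1 (g.1.symm x)) = x
    filter_upwards [h] with x hx
    rw [hx, MeasurableEquiv.apply_symm_apply]

end MPEquiv

/-- `Aut(X, m)`: the group of `m`-preserving automorphisms of `X`, two of them being identified if
they agree `m`-almost everywhere. Its (quotient) topology is the weak topology. -/
abbrev MPAut (m : Measure X) : Type _ := MPEquiv m ⧸ MPEquiv.aeTrivial m

end Aut

section Hilbert

variable {H : Type*} [NormedAddCommGroup H] [InnerProductSpace ℝ H]

/-- `𝒢` is a uniformly bounded group of invertible operators which fix `f`. -/
structure IsUniformlyBoundedSymmetryGroup (f : H → ℂ) (𝒢 : Subgroup (H ≃L[ℝ] H)) : Prop where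
  bounded : ∃ C : ℝ, ∀ u ∈ 𝒢, ‖(u : H →L[ℝ] H)‖ ≤ C
  map_eq : ∀ u ∈ 𝒢, ∀ ξ : H, f (u ξ) = f ξ

/-- The strong operator topology (pointwise convergence on `H`) on a group of invertible
operators. -/
@[reducible] def strongOperatorTopology (𝒢 : Subgroup (H ≃L[ℝ] H)) : TopologicalSpace 𝒢 :=
  TopologicalSpace.induced (fun (u : 𝒢) (ξ : H) => (u : H ≃L[ℝ] H) ξ) Pi.topologicalSpace

variable {X : Type*} [MeasurableSpace X]

/-- `φ` is a positive measurable function and `f(ξ) = ∫ exp(i φ(x) [Tξ](x)) dm(x)` for all `ξ`. -/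
structure Represents (f : H → ℂ) (m : Measure X) (T : H →L[ℝ] Lp ℝ 2 m) (φ : X → ℝ) : Prop where
  measurable : Measurable φ
  pos : ∀ x, 0 < φ x
  eq_integral : ∀ ξ : H, f ξ = ∫ x, Complex.exp (Complex.I * ((φ x * T ξ x : ℝ) : ℂ)) ∂m

/-- There is a homomorphism `β : 𝒢 → Aut(X, m)`, continuous from the strong operator topology to the
weak topology, with `[T(uξ)](x) = [Tξ](β(u)⁻¹ x)` and `φ(β(u) x) = φ(x)` for `m`-a.e. `x`. The two
identities do not depend on the representative `t` of the class `β(u)`. -/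
def IsEquivariantFor {m : Measure X} (T : H →L[ℝ] Lp ℝ 2 m) (φ : X → ℝ)
    (𝒢 : Subgroup (H ≃L[ℝ] H)) : Prop :=
  ∃ β : 𝒢 →* MPAut m,
    Continuous[strongOperatorTopology 𝒢, inferInstance] β ∧
    ∀ (u : 𝒢) (t : MPEquiv m), (QuotientGroup.mk t : MPAut m) = β u →
      (∀ ξ : H, ∀ᵐ x ∂m, T ((u : H ≃L[ℝ] H) ξ) x = T ξ (t.1.symm x)) ∧
      ∀ᵐ x ∂m, φ (t.1 x) = φ x

end Hilbert

end

/-! Realisation. For a dense sequence `d` in `H`, Bochner's theorem on Euclidean spaces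
(`exists_charFun_eq`) gives laws for finitely many `d k`, and tightness yields one law `m` on `ℕ →
ℝ` with characteristic functional `a ↦ f (∑ a k • d k)` (`exists_sequence_law`). By continuity of
`f` at `0`, coordinates along suitable `d (k n) → ξ` converge a.e. to a variable `L ξ`. It is a.e.
linear in `ξ`, and `f ξ = ∫ exp(i L ξ)`. Since `L ξ` need not be square integrable, a positive
weight `s` is sought with `s * L ξ` in `L²`; then `T ξ = s * L ξ` and `φ = 1 / s`.

Weights. Averaging the continuity estimate over Gaussian coefficients, where the inner product of
`H` enters, bounds `∑ (L (ξ i))²` in probability, uniformly over `∑ ‖ξ i‖² ≤ 1`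
(`exists_sum_sq_tail_bound`). The `L²` functions below such sums form a convex set whose closure
misses a large multiple of the indicator of any given non-null `E`. Hahn–Banach separation produces
a nonnegative weight, not a.e. zero on `E`, that makes the process square integrable
(`exists_weight`).

Equivariance. No average over the group is needed: among the weights `0 ≤ s ≤ 1` with `‖s * L ξ‖₂ ≤
1` on the `𝒢`-invariant set `{ξ | ∀ u ∈ 𝒢, ‖u ξ‖ ≤ 1}`, the one closest to `1` in `L²` is unique,
hence invariant, and minimality makes it positive a.e. (`exists_canonical_weight`). Uniform
boundedness puts a ball inside the invariant set, so `T` is bounded. The operator `u` acts on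
sequences by `x ↦ (L (u (d k)) x)_k`. This preserves `m` because `f ∘ u = f`, and it is invertible
a.e.; a change on a null set turns it into a Borel automorphism. Convergence in probability of the
process gives weak continuity.

If `f` generates the neighbourhoods of `0`, the group of all invertible operators fixing `f` is
itself uniformly bounded, so one weight serves every group, and `T ξ → 0` forces `f ξ → 1`, hence `ξ
→ 0`. -/

open ProbabilityTheory in
theorem integral_pi_pair {E : Type*} [MeasurableSpace E] (P : Measure E) [IsProbabilityMeasure P]
    {N : ℕ} {i j : Fin N} (hij : i ≠ j) {k : E × E → ℂ} (hk : StronglyMeasurable k) :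
    ∫ ω, k (ω i, ω j) ∂(Measure.pi fun _ : Fin N => P) = ∫ z, k z ∂(P.prod P) := by
  have hind : iIndepFun (fun (i : Fin N) (ω : Fin N → E) => ω i)
      (Measure.pi fun _ : Fin N => P) :=
    iIndepFun_pi (X := fun _ x => x) (fun _ => aemeasurable_id)
  have h := (indepFun_iff_map_prod_eq_prod_map_map (measurable_pi_apply i).aemeasurable
    (measurable_pi_apply j).aemeasurable).1 (hind.indepFun hij)
  have hmap : ∀ l : Fin N, (Measure.pi fun _ : Fin N => P).map (fun ω => ω l) = P := fun l =>
    (measurePreserving_eval (fun _ : Fin N => P) l).map_eq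
  rw [hmap, hmap] at h
  rw [← h, integral_map (by fun_prop) hk.aestronglyMeasurable]

/-! ### Positive definite functions: elementary bounds and integrated positivity. -/

namespace IsNormalizedPosDef

section Group

variable {H : Type*} [AddGroup H] [TopologicalSpace H] {f : H → ℂ}

theorem two_point (hf : IsNormalizedPosDef f) (ξ : H) (c : ℂ) :
    0 ≤ 1 + c * f ξ + (starRingEnd ℂ) c * f (-ξ) + (starRingEnd ℂ) c * c := by
  have h := hf.posDef 2 ![0, ξ] ![1, c]
  simp only [Fin.sum_univ_two, Matrix.cons_val_zero, Matrix.cons_val_one, map_one, sub_self,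
    hf.map_zero, sub_zero, zero_sub, neg_zero, one_mul, mul_one] at h
  convert h using 1
  ring

theorem map_neg (hf : IsNormalizedPosDef f) (ξ : H) : f (-ξ) = (starRingEnd ℂ) (f ξ) := by
  have h1 := (Complex.nonneg_iff.1 (hf.two_point ξ 1)).2
  have h2 := (Complex.nonneg_iff.1 (hf.two_point ξ Complex.I)).2
  simp at h1 h2
  apply Complex.ext
  · simp; linarith
  · simp; linarith

theorem norm_le_one (hf : IsNormalizedPosDef f) (ξ : H) : ‖f ξ‖ ≤ 1 := by
  -- With this coefficient the two-point inequality reads `1 - |f ξ|² ≥ 0`.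
  have h1 := (Complex.nonneg_iff.1 (hf.two_point ξ (-(starRingEnd ℂ) (f ξ)))).1
  rw [hf.map_neg] at h1
  simp at h1
  have h2 : ‖f ξ‖ ^ 2 ≤ 1 := by
    rw [Complex.sq_norm, Complex.normSq_apply]
    nlinarith
  nlinarith [norm_nonneg (f ξ)]

end Group

section Integral

variable {E : Type*} [AddCommGroup E] [TopologicalSpace E] [IsTopologicalAddGroup E]
  [SecondCountableTopology E] [MeasurableSpace E] [BorelSpace E] {F : E → ℂ}

theorem integrable_sub (hF : IsNormalizedPosDef F) (P : Measure (E × E)) [IsFiniteMeasure P] :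
    Integrable (fun z : E × E => F (z.1 - z.2)) P := by
  have hm : Measurable fun z : E × E => F (z.1 - z.2) :=
    hF.continuous.measurable.comp (measurable_fst.sub measurable_snd)
  exact Integrable.of_bound hm.aestronglyMeasurable 1
    (ae_of_all _ fun z => hF.norm_le_one _)

/-- A continuous positive definite function is positive definite in the integrated sense: average
the finite inequality over independent samples. -/
theorem integral_prob_nonneg (hF : IsNormalizedPosDef F) (P : Measure E)
    [IsProbabilityMeasure P] : 0 ≤ ∫ z, F (z.1 - z.2) ∂(P.prod P) := by
  set J := ∫ z, F (z.1 - z.2) ∂(P.prod P) with hJ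
  have hm : Measurable fun z : E × E => F (z.1 - z.2) :=
    hF.continuous.measurable.comp (measurable_fst.sub measurable_snd)
  -- For `N` independent samples each diagonal term contributes `F 0 = 1` and each off-diagonal term
  -- `J`. The quadratic growth in `N` then excludes a negative `J`.
  have key : ∀ N : ℕ, 0 ≤ (N : ℂ) + (N : ℂ) * ((N : ℂ) - 1) * J := by
    intro N
    have h0 : 0 ≤ ∫ ω, ∑ i, ∑ j, F (ω j - ω i) ∂(Measure.pi fun _ : Fin N => P) := by
      apply integral_nonneg
      intro ω
      simpa using hF.posDef N ω 1
    have hmeas : ∀ i j : Fin N, Integrable (fun ω : Fin N → E => F (ω j - ω i))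
        (Measure.pi fun _ : Fin N => P) := fun i j =>
      Integrable.of_bound (hm.comp (f := fun ω : Fin N → E => (ω j, ω i))
        (by fun_prop)).aestronglyMeasurable 1 (ae_of_all _ fun z => hF.norm_le_one _)
    rw [integral_finsetSum _ (fun i _ => integrable_finsetSum _ fun j _ => hmeas i j)] at h0
    simp_rw [integral_finsetSum _ (fun j _ => hmeas _ j)] at h0
    have hterm : ∀ i j : Fin N, ∫ ω, F (ω j - ω i) ∂(Measure.pi fun _ : Fin N => P)
        = J + if i = j then 1 - J else 0 := by
      intro i j
      split_ifs with hij
      · subst hij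
        simp [hF.map_zero]
      · rw [integral_pi_pair P (Ne.symm hij) hm.stronglyMeasurable (k := fun z => F (z.1 - z.2)),
          add_zero]
    simp_rw [hterm, Finset.sum_add_distrib] at h0
    simp only [Finset.sum_const, Finset.card_univ, Fintype.card_fin, nsmul_eq_mul,
      Finset.sum_ite_eq, Finset.mem_univ, if_true] at h0
    convert h0 using 1
    ring
  have him : J.im = 0 := by
    have := (Complex.nonneg_iff.1 (key 2)).2
    norm_num at this
    exact this.symm ▸ rfl
  refine Complex.nonneg_iff.2 ⟨?_, him.symm⟩
  by_contra! hneg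
  obtain ⟨N, hN⟩ := exists_nat_gt (1 / (-J.re))
  have h := (Complex.nonneg_iff.1 (key (N + 1))).1
  simp [him] at h
  have h1 : 1 < N * (-J.re) := by rwa [div_lt_iff₀ (by linarith)] at hN
  nlinarith [(Nat.cast_nonneg N : (0 : ℝ) ≤ N)]

theorem integral_finite_nonneg (hF : IsNormalizedPosDef F) (P : Measure E)
    [IsFiniteMeasure P] : 0 ≤ ∫ z, F (z.1 - z.2) ∂(P.prod P) := by
  rcases eq_or_ne P 0 with rfl | hP
  · simp
  have : NeZero P := ⟨hP⟩
  have h := hF.integral_prob_nonneg ((P Set.univ)⁻¹ • P)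
  rw [Measure.prod_smul_left, Measure.prod_smul_right, integral_smul_measure,
    integral_smul_measure] at h
  have hc : 0 < (P Set.univ)⁻¹.toReal :=
    ENNReal.toReal_pos (by simp) (by simp [hP])
  have h2 : 0 ≤ (((P Set.univ)⁻¹.toReal : ℂ)⁻¹ * ((P Set.univ)⁻¹.toReal : ℂ)⁻¹)
      * ((P Set.univ)⁻¹.toReal • (P Set.univ)⁻¹.toReal • ∫ z, F (z.1 - z.2) ∂(P.prod P)) := by
    refine mul_nonneg ?_ h
    rw [← Complex.ofReal_inv, ← Complex.ofReal_mul]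
    exact Complex.zero_le_real.2 (by positivity)
  have hc' : ((P Set.univ)⁻¹.toReal : ℂ) ≠ 0 := by exact_mod_cast hc.ne'
  rw [Complex.real_smul, Complex.real_smul] at h2
  convert h2 using 1
  field_simp

end Integral

/-- The character is absorbed into the coefficients. Positivity of a Fourier transform at `x`
thereby reduces to positivity at `0`. -/
theorem mul_char {E : Type*} [NormedAddCommGroup E] [InnerProductSpace ℝ E] {F : E → ℂ}
    (hF : IsNormalizedPosDef F) (x : E) :
    IsNormalizedPosDef fun a : E => F a * Complex.exp (-(inner ℝ x a : ℝ) * Complex.I) where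
  continuous := by have := hF.continuous; fun_prop
  map_zero := by simp [hF.map_zero]
  posDef n ξ c := by
    have h := hF.posDef n ξ fun j => c j * Complex.exp (-(inner ℝ x (ξ j) : ℝ) * Complex.I)
    refine h.trans_eq (Finset.sum_congr rfl fun i _ => Finset.sum_congr rfl fun j _ => ?_)
    rw [inner_sub_right, map_mul, ← Complex.exp_conj]
    simp only [map_mul, _root_.map_neg, Complex.conj_ofReal, Complex.conj_I]
    have : Complex.exp (-((inner ℝ x (ξ j) - inner ℝ x (ξ i) : ℝ) : ℂ) * Complex.I) =
      Complex.exp (-(inner ℝ x (ξ i) : ℝ) * -Complex.I) *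
        Complex.exp (-(inner ℝ x (ξ j) : ℝ) * Complex.I) := by
      rw [← Complex.exp_add]; congr 1; push_cast; ring
    rw [this]; ring

/-! ### Bochner's theorem on Euclidean spaces by Gaussian smoothing. -/

section Bochner

variable {E : Type*} [NormedAddCommGroup E] [InnerProductSpace ℝ E] [FiniteDimensional ℝ E]
  [MeasurableSpace E] [BorelSpace E] {F : E → ℂ}

theorem integrable_rexp_neg_mul_sq_norm {b : ℝ} (hb : 0 < b) :
    Integrable fun v : E => Real.exp (-b * ‖v‖ ^ 2) := by
  have h := (GaussianFourier.integrable_cexp_neg_mul_sq_norm_add (V := E) (b := (b : ℂ))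
    (by simpa using hb) 0 0).re
  refine h.congr (ae_of_all _ fun v => ?_)
  simp only [zero_mul, add_zero]
  rw [show (-(b : ℂ) * (‖v‖ : ℂ) ^ 2) = ((-b * ‖v‖ ^ 2 : ℝ) : ℂ) by push_cast; ring,
    ← Complex.ofReal_exp]
  rfl

/-- Integrated positivity for the density `g v = exp(-2ε‖v‖²)`. Completing the square, `g t * g (a +
t) = exp(-4ε‖t + a/2‖²) * exp(-ε‖a‖²)`, so integrating out `t` leaves a positive constant `K`. -/
theorem integral_mul_gaussian_nonneg (hF : IsNormalizedPosDef F) {ε : ℝ} (hε : 0 < ε) :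
    0 ≤ ∫ a : E, F a * (Real.exp (-ε * ‖a‖ ^ 2) : ℂ) := by
  have h2 : (0 : ℝ) < 2 * ε := by linarith
  have hg := integrable_rexp_neg_mul_sq_norm (E := E) h2
  set g : E → ℝ := fun v => Real.exp (-(2 * ε) * ‖v‖ ^ 2) with hgdef
  have hgm : Measurable fun v => Real.toNNReal (g v) := by fun_prop
  set P : Measure E := volume.withDensity fun v => (Real.toNNReal (g v) : ENNReal) with hP
  have : IsFiniteMeasure P := isFiniteMeasure_withDensity_ofReal hg.2
  have h := hF.integral_finite_nonneg P
  rw [integral_prod_symm _ (hF.integrable_sub _), hP] at h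
  simp_rw [integral_withDensity_eq_integral_smul hgm] at h
  have hgpos : ∀ v, 0 ≤ g v := fun v => (Real.exp_pos _).le
  have e1 : ∀ t : E, ∫ s, Real.toNNReal (g s) • F (s - t)
      = ∫ a, (g (a + t) : ℂ) * F a := by
    intro t
    rw [← integral_add_right_eq_self (fun s => Real.toNNReal (g s) • F (s - t)) t]
    refine integral_congr_ae (ae_of_all _ fun a => ?_)
    simp only [add_sub_cancel_right, NNReal.smul_def, Real.coe_toNNReal _ (hgpos _),
      Complex.real_smul]
  simp_rw [e1] at h
  have e2 : ∀ t : E, Real.toNNReal (g t) • ∫ a, (g (a + t) : ℂ) * F a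
      = ∫ a, (g t : ℂ) * ((g (a + t) : ℂ) * F a) := by
    intro t
    rw [NNReal.smul_def, Real.coe_toNNReal _ (hgpos _), Complex.real_smul, integral_const_mul]
  simp_rw [e2] at h
  have hgc : Continuous g := by fun_prop
  have hFc := hF.continuous
  have hshear : MeasurePreserving (fun z : E × E => (z.1, z.2 + z.1))
      ((volume : Measure E).prod volume) ((volume : Measure E).prod volume) := by
    have := measurePreserving_prod_add (volume : Measure E) (volume : Measure E)
    simpa [add_comm] using this
  have hint : Integrable (fun z : E × E => (g z.1 : ℂ) * ((g (z.2 + z.1) : ℂ) * F z.2))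
      (volume.prod volume) := by
    have h0 : Integrable (fun z : E × E => (g z.1 : ℂ) * (g z.2 : ℂ)) (volume.prod volume) :=
      hg.ofReal.mul_prod hg.ofReal
    have h1 := (hshear.integrable_comp h0.aestronglyMeasurable).2 h0
    refine Integrable.mono h1 (by fun_prop) (ae_of_all _ fun z => ?_)
    simp only [Function.comp, norm_mul]
    have := hF.norm_le_one z.2
    have h3 : 0 ≤ ‖(g (z.2 + z.1) : ℂ)‖ := norm_nonneg _
    gcongr
    nlinarith
  rw [integral_integral_swap hint] at h
  set K : ℝ := ∫ t : E, Real.exp (-(4 * ε) * ‖t‖ ^ 2) with hK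
  have hKpos : 0 < K := by
    rw [hK, GaussianFourier.integral_rexp_neg_mul_sq_norm (by linarith)]
    positivity
  have e3 : ∀ a : E, ∫ t, (g t : ℂ) * ((g (a + t) : ℂ) * F a)
      = (K : ℂ) * (F a * (Real.exp (-ε * ‖a‖ ^ 2) : ℂ)) := by
    intro a
    have : ∀ t : E, (g t : ℂ) * ((g (a + t) : ℂ) * F a) =
        ((Real.exp (-(4 * ε) * ‖t + (2⁻¹ : ℝ) • a‖ ^ 2) : ℝ) : ℂ) *
          (F a * (Real.exp (-ε * ‖a‖ ^ 2) : ℂ)) := by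
      intro t
      have : g t * g (a + t) =
          Real.exp (-(4 * ε) * ‖t + (2⁻¹ : ℝ) • a‖ ^ 2) * Real.exp (-ε * ‖a‖ ^ 2) := by
        rw [hgdef]
        simp only
        rw [← Real.exp_add, ← Real.exp_add]
        congr 1
        rw [@norm_add_sq_real, @norm_add_sq_real, inner_smul_right, norm_smul,
          real_inner_comm t a]
        norm_num
        ring
      calc (g t : ℂ) * ((g (a + t) : ℂ) * F a) = ((g t * g (a + t) : ℝ) : ℂ) * F a := by
            push_cast; ring
        _ = _ := by rw [this]; push_cast; ring
    simp_rw [this]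
    rw [integral_mul_const, integral_complex_ofReal,
      integral_add_right_eq_self (fun t : E => Real.exp (-(4 * ε) * ‖t‖ ^ 2))]
  simp_rw [e3] at h
  rw [integral_const_mul] at h
  have hK' : (K : ℂ) ≠ 0 := by exact_mod_cast hKpos.ne'
  have h4 := mul_nonneg (Complex.zero_le_real.2 (inv_nonneg.2 hKpos.le)) h
  rwa [Complex.ofReal_inv, inv_mul_cancel_left₀ hK'] at h4

end Bochner

end IsNormalizedPosDef

/-- A tight sequence of probability measures has a limit measure, which computes all limits of
characteristic integrals that exist along the sequence. -/
theorem exists_probabilityMeasure_of_isTight {Ω : Type*} [TopologicalSpace Ω] [T2Space Ω]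
    [MeasurableSpace Ω] [BorelSpace Ω] (S : ℕ → ProbabilityMeasure Ω)
    (hS : IsTightMeasureSet (Set.range fun n => (S n : Measure Ω))) :
    ∃ μ : ProbabilityMeasure Ω, ∀ Y : Ω → ℝ, Continuous Y → ∀ z : ℂ,
      Tendsto (fun n => ∫ x, Complex.exp ((Y x : ℂ) * Complex.I) ∂(S n : Measure Ω)) atTop (𝓝 z) →
      ∫ x, Complex.exp ((Y x : ℂ) * Complex.I) ∂(μ : Measure Ω) = z := by
  have hcomp : IsCompact (closure (Set.range S)) := by
    apply isCompact_closure_of_isTightMeasureSet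
    convert hS using 1
    ext x
    simp
  -- A cluster point suffices: the integrals at `μ` are cluster points of the numerical sequences,
  -- hence equal to their limits where these exist.
  obtain ⟨μ, -, hμ⟩ := hcomp.exists_mapClusterPt (f := atTop) (u := S)
    (tendsto_principal.2 (Eventually.of_forall fun n => subset_closure ⟨n, rfl⟩))
  refine ⟨μ, fun Y hY z hz => ?_⟩
  let g : BoundedContinuousFunction Ω ℂ := BoundedContinuousFunction.ofNormedAddCommGroup
    (fun x => Complex.exp ((Y x : ℂ) * Complex.I)) (by fun_prop) 1
    fun x => (Complex.norm_exp_ofReal_mul_I _).le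
  have hcont : Continuous fun P : ProbabilityMeasure Ω =>
      ∫ x, Complex.exp ((Y x : ℂ) * Complex.I) ∂(P : Measure Ω) :=
    continuous_iff_continuousAt.2 fun P =>
      (ProbabilityMeasure.tendsto_iff_forall_integral_rclike_tendsto ℂ).1 tendsto_id g
  have hcl : ClusterPt _ (map _ atTop) := hμ.continuousAt_comp hcont.continuousAt
  exact eq_of_nhds_neBot (hcl.mono hz)

namespace IsNormalizedPosDef

variable {E : Type*} [NormedAddCommGroup E] [InnerProductSpace ℝ E] [FiniteDimensional ℝ E]
  [MeasurableSpace E] [BorelSpace E] {F : E → ℂ}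

/-- The Fourier transform `p` of `F` times a Gaussian is nonnegative and bounded. A second Gaussian
factor makes it an integrable density, and Fubini identifies the characteristic function as an
average of `F` at scale `r` around `b`. -/
theorem exists_smoothed_measure (hF : IsNormalizedPosDef F) {r : ℝ} (hr : 0 < r) :
    ∃ (ν : Measure E) (C : ℂ), IsFiniteMeasure ν ∧ C ≠ 0 ∧ ∀ b : E, charFun ν b =
      C * ∫ z : E, F (b + r • z) *
        ((Real.exp (-r ^ 2 * ‖b + r • z‖ ^ 2) * Real.exp (-1 * ‖z‖ ^ 2) : ℝ) : ℂ) := by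
  have hε : (0 : ℝ) < r ^ 2 := by positivity
  have hδ : (0 : ℝ) < r ^ 2 / 4 := by positivity
  set ε := r ^ 2 with hεdef
  -- This makes `4 * δ = r²`, so the transform of `exp(-δ‖x‖²)` is a multiple of `exp(-‖(a -
  -- b)/r‖²)`.
  set δ := ε / 4 with hδdef
  have hFc := hF.continuous
  have hgε := integrable_rexp_neg_mul_sq_norm (E := E) hε
  have hgδ := integrable_rexp_neg_mul_sq_norm (E := E) hδ
  set q : E → E → ℂ := fun x a =>
    F a * Complex.exp (-(inner ℝ x a : ℝ) * Complex.I) * (Real.exp (-ε * ‖a‖ ^ 2) : ℂ) with hq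
  set p : E → ℂ := fun x => ∫ a : E, q x a with hp
  have hqn : ∀ x a, ‖q x a‖ ≤ Real.exp (-ε * ‖a‖ ^ 2) := by
    intro x a
    simp only [hq, norm_mul]
    rw [show (-(inner ℝ x a : ℝ) * Complex.I : ℂ) = ((-(inner ℝ x a : ℝ) : ℝ) : ℂ) * Complex.I by
      push_cast; ring, Complex.norm_exp_ofReal_mul_I, mul_one, Complex.norm_real,
      Real.norm_of_nonneg (Real.exp_pos _).le]
    exact mul_le_of_le_one_left (Real.exp_pos _).le (hF.norm_le_one a)
  have hpc : Continuous p := by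
    refine continuous_of_dominated (bound := fun a => Real.exp (-ε * ‖a‖ ^ 2)) ?_ ?_ hgε ?_
    · intro x
      exact (by fun_prop : Continuous (q x)).aestronglyMeasurable
    · exact fun x => ae_of_all _ (hqn x)
    · exact ae_of_all _ fun a => by fun_prop
  have hp0 : ∀ x, 0 ≤ p x := fun x => (hF.mul_char x).integral_mul_gaussian_nonneg hε
  have hpre : ∀ x, p x = ((p x).re : ℂ) := fun x =>
    Complex.ext rfl (by simpa using (Complex.nonneg_iff.1 (hp0 x)).2.symm)
  have hpB : ∀ x, ‖p x‖ ≤ ∫ a : E, Real.exp (-ε * ‖a‖ ^ 2) := fun x =>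
    norm_integral_le_of_norm_le hgε (ae_of_all _ (hqn x))
  have hpm : Measurable fun x => Real.toNNReal ((p x).re * Real.exp (-δ * ‖x‖ ^ 2)) := by
    fun_prop
  have hpint : Integrable fun x => (p x).re * Real.exp (-δ * ‖x‖ ^ 2) := by
    refine hgδ.bdd_mul (c := ∫ a : E, Real.exp (-ε * ‖a‖ ^ 2)) (by fun_prop)
      (ae_of_all _ fun x => ?_)
    exact (Complex.abs_re_le_norm _).trans (hpB x)
  set ν : Measure E := volume.withDensity
    fun x => (Real.toNNReal ((p x).re * Real.exp (-δ * ‖x‖ ^ 2)) : ENNReal) with hν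
  have hfin : IsFiniteMeasure ν := isFiniteMeasure_withDensity_ofReal hpint.2
  set D : ℂ := (Real.pi / (δ : ℂ)) ^ ((Module.finrank ℝ E : ℂ) / 2) with hD
  have hD0 : D ≠ 0 := by
    rw [hD, Complex.cpow_ne_zero_iff]
    left
    exact div_ne_zero (by exact_mod_cast Real.pi_ne_zero) (by exact_mod_cast hδ.ne')
  refine ⟨ν, D * ((r ^ Module.finrank ℝ E : ℝ) : ℂ), hfin,
    mul_ne_zero hD0 (by exact_mod_cast (pow_pos hr _).ne'), fun b => ?_⟩
  rw [charFun_apply, hν, integral_withDensity_eq_integral_smul hpm]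
  have e1 : ∀ x : E, Real.toNNReal ((p x).re * Real.exp (-δ * ‖x‖ ^ 2)) •
      Complex.exp ((inner ℝ x b : ℝ) * Complex.I) =
      ∫ a, q x a * ((Real.exp (-δ * ‖x‖ ^ 2) : ℂ) * Complex.exp ((inner ℝ x b : ℝ) * Complex.I)) := by
    intro x
    rw [integral_mul_const, NNReal.smul_def, Real.coe_toNNReal _ (mul_nonneg
      (Complex.nonneg_iff.1 (hp0 x)).1 (Real.exp_pos _).le), Complex.real_smul,
      Complex.ofReal_mul, ← hpre x]
    ring
  simp_rw [e1]
  rw [integral_integral_swap]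
  swap
  · have h0 : Integrable (fun z : E × E => Real.exp (-δ * ‖z.1‖ ^ 2) * Real.exp (-ε * ‖z.2‖ ^ 2))
        (volume.prod volume) := hgδ.mul_prod hgε
    refine h0.mono' (by fun_prop) (ae_of_all _ fun z => ?_)
    simp only [Function.uncurry, norm_mul, Complex.norm_exp_ofReal_mul_I, mul_one,
      Complex.norm_real, Real.norm_of_nonneg (Real.exp_pos _).le]
    rw [mul_comm]
    gcongr
    exact hqn _ _
  have e2 : ∀ a : E, ∫ x, q x a * ((Real.exp (-δ * ‖x‖ ^ 2) : ℂ) *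
      Complex.exp ((inner ℝ x b : ℝ) * Complex.I)) =
      D * (F a * ((Real.exp (-ε * ‖a‖ ^ 2) * Real.exp (-1 * ‖r⁻¹ • (a - b)‖ ^ 2) : ℝ) : ℂ)) := by
    intro a
    have h1 : ∀ x : E, q x a * ((Real.exp (-δ * ‖x‖ ^ 2) : ℂ) *
        Complex.exp ((inner ℝ x b : ℝ) * Complex.I)) =
        (F a * (Real.exp (-ε * ‖a‖ ^ 2) : ℂ)) *
          Complex.exp (-(δ : ℂ) * (‖x‖ : ℂ) ^ 2 + Complex.I * (inner ℝ (b - a) x : ℝ)) := by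
      intro x
      have : Complex.exp (-(δ : ℂ) * (‖x‖ : ℂ) ^ 2 + Complex.I * (inner ℝ (b - a) x : ℝ)) =
          Complex.exp (-(inner ℝ x a : ℝ) * Complex.I) * ((Real.exp (-δ * ‖x‖ ^ 2) : ℂ) *
        Complex.exp ((inner ℝ x b : ℝ) * Complex.I)) := by
        rw [Complex.ofReal_exp, ← Complex.exp_add, ← Complex.exp_add, inner_sub_left,
          real_inner_comm x b, real_inner_comm x a]
        congr 1; push_cast; ring
      rw [this]; ring
    simp_rw [h1]
    rw [integral_const_mul, GaussianFourier.integral_cexp_neg_mul_sq_norm_add (by simpa using hδ)]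
    have h3 : Complex.exp (Complex.I ^ 2 * (‖b - a‖ : ℂ) ^ 2 / (4 * (δ : ℂ))) =
        (Real.exp (-1 * ‖r⁻¹ • (a - b)‖ ^ 2) : ℂ) := by
      rw [Complex.ofReal_exp]
      congr 1
      rw [norm_smul, norm_sub_rev a b, hδdef, hεdef, Complex.I_sq, norm_inv,
        Real.norm_of_nonneg hr.le]
      have : (r : ℂ) ≠ 0 := by exact_mod_cast hr.ne'
      push_cast
      field_simp
    rw [h3]; push_cast; ring
  simp_rw [e2]
  rw [integral_const_mul, mul_assoc]
  congr 1
  set G : E → ℂ := fun a =>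
    F a * ((Real.exp (-ε * ‖a‖ ^ 2) * Real.exp (-1 * ‖r⁻¹ • (a - b)‖ ^ 2) : ℝ) : ℂ) with hG
  have e3 : ∀ z : E, F (b + r • z) *
        ((Real.exp (-ε * ‖b + r • z‖ ^ 2) * Real.exp (-1 * ‖z‖ ^ 2) : ℝ) : ℂ) =
        (fun y => G (b + y)) (r • z) := by
    intro z
    simp only [hG, add_sub_cancel_left, smul_smul, inv_mul_cancel₀ hr.ne', one_smul]
  simp_rw [e3]
  rw [Measure.integral_comp_smul volume (fun y => G (b + y)) r, integral_add_left_eq_self,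
    Complex.real_smul, abs_of_pos (by positivity), ← mul_assoc, ← Complex.ofReal_mul,
    mul_inv_cancel₀ (by positivity), Complex.ofReal_one, one_mul]

theorem tendsto_smoothed_integral (hF : IsNormalizedPosDef F) {r : ℕ → ℝ}
    (hr : Tendsto r atTop (𝓝 0)) (b : E) :
    Tendsto (fun n => ∫ z : E, F (b + r n • z) *
        ((Real.exp (-(r n) ^ 2 * ‖b + r n • z‖ ^ 2) * Real.exp (-1 * ‖z‖ ^ 2) : ℝ) : ℂ)) atTop
      (𝓝 (F b * ((∫ z : E, Real.exp (-1 * ‖z‖ ^ 2) : ℝ) : ℂ))) := by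
  have hFc := hF.continuous
  rw [← integral_complex_ofReal, ← integral_const_mul]
  refine tendsto_integral_of_dominated_convergence (fun z => Real.exp (-1 * ‖z‖ ^ 2)) ?_
    (integrable_rexp_neg_mul_sq_norm one_pos) ?_ ?_
  · exact fun n => (by fun_prop : Continuous _).aestronglyMeasurable
  · intro n
    refine ae_of_all _ fun z => ?_
    rw [norm_mul, Complex.norm_real, Real.norm_of_nonneg (by positivity)]
    have h1 : Real.exp (-(r n) ^ 2 * ‖b + r n • z‖ ^ 2) ≤ 1 :=
      Real.exp_le_one_iff.2 (by nlinarith [mul_nonneg (sq_nonneg (r n)) (sq_nonneg ‖b + r n • z‖)])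
    calc _ ≤ 1 * (1 * Real.exp (-1 * ‖z‖ ^ 2)) := by
          gcongr
          exact hF.norm_le_one _
      _ = _ := by ring
  · refine ae_of_all _ fun z => ?_
    have hc : Continuous fun s : ℝ => F (b + s • z) *
        ((Real.exp (-s ^ 2 * ‖b + s • z‖ ^ 2) * Real.exp (-1 * ‖z‖ ^ 2) : ℝ) : ℂ) := by
      fun_prop
    have := (hc.tendsto 0).comp hr
    simpa [Function.comp_def] using this

/-- **Bochner's theorem** on a Euclidean space. -/
theorem exists_charFun_eq (hF : IsNormalizedPosDef F) :
    ∃ μ : ProbabilityMeasure E, ∀ t, charFun (μ : Measure E) t = F t := by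
  have hrpos : ∀ n : ℕ, (0 : ℝ) < 1 / ((n : ℝ) + 1) := fun n => by positivity
  have hr : Tendsto (fun n : ℕ => 1 / ((n : ℝ) + 1)) atTop (𝓝 0) :=
    tendsto_one_div_add_atTop_nhds_zero_nat
  choose ν C hfin hC hν using fun n => hF.exists_smoothed_measure (hrpos n)
  set k : ℕ → E → ℂ := fun n b => ∫ z : E, F (b + (1 / ((n : ℝ) + 1)) • z) *
        ((Real.exp (-(1 / ((n : ℝ) + 1)) ^ 2 * ‖b + (1 / ((n : ℝ) + 1)) • z‖ ^ 2) *
          Real.exp (-1 * ‖z‖ ^ 2) : ℝ) : ℂ) with hk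
  set K : ℝ := ∫ z : E, Real.exp (-1 * ‖z‖ ^ 2) with hK
  have hKpos : 0 < K := by
    rw [hK, GaussianFourier.integral_rexp_neg_mul_sq_norm one_pos]
    positivity
  have hK0 : (K : ℂ) ≠ 0 := by exact_mod_cast hKpos.ne'
  have hlim : ∀ b, Tendsto (fun n => k n b) atTop (𝓝 (F b * K)) :=
    hF.tendsto_smoothed_integral hr
  have h0 : ∀ᶠ n in atTop, k n 0 ≠ 0 :=
    (hlim 0).eventually_ne (by rw [hF.map_zero, one_mul]; exact hK0)
  -- The mass of `ν n` is `C n * k n 0`, known to be nonzero only from `N` on; hence the shift by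
  -- `N` before normalising.
  obtain ⟨N, hN⟩ := eventually_atTop.1 h0
  have hmass : ∀ n, ((ν n).real Set.univ : ℂ) = C n * k n 0 := fun n => by
    rw [← charFun_zero, hν]
  have hne : ∀ n, ν (n + N) ≠ 0 := by
    intro n h
    have := hmass (n + N)
    rw [h] at this
    simp only [measureReal_zero, Pi.zero_apply, Complex.ofReal_zero] at this
    exact (mul_ne_zero (hC _) (hN _ (Nat.le_add_left _ _))) this.symm
  set μ : ℕ → Measure E := fun n => ((ν (n + N)) Set.univ)⁻¹ • ν (n + N) with hμ
  have hprob : ∀ n, IsProbabilityMeasure (μ n) := fun n => by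
    have : NeZero (ν (n + N)) := ⟨hne n⟩
    rw [hμ]; infer_instance
  have hchar : ∀ n t, charFun (μ n) t = k (n + N) t / k (n + N) 0 := by
    intro n t
    rw [hμ, charFun_apply, integral_smul_measure, ← charFun_apply, hν, Complex.real_smul,
      ENNReal.toReal_inv]
    change (((ν (n + N)).real Set.univ)⁻¹ : ℝ) * (C (n + N) * k (n + N) t) = _
    rw [Complex.ofReal_inv, hmass]
    have := hC (n + N)
    have := hN (n + N) (Nat.le_add_left _ _)
    field_simp
  have hlimF : ∀ t, Tendsto (fun n => charFun (μ n) t) atTop (𝓝 (F t)) := by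
    intro t
    simp_rw [hchar]
    have h := ((hlim t).div (hlim 0) (by rw [hF.map_zero, one_mul]; exact hK0)).comp
      (tendsto_add_atTop_nat N)
    rw [hF.map_zero, one_mul, mul_div_cancel_right₀ _ hK0] at h
    exact h
  have htight := isTightMeasureSet_of_tendsto_charFun hF.continuous.continuousAt hlimF
  obtain ⟨μ₀, hμ₀⟩ := exists_probabilityMeasure_of_isTight (fun n => ⟨μ n, hprob n⟩) htight
  exact ⟨μ₀, fun t => hμ₀ _ (by fun_prop) _ (hlimF t)⟩

end IsNormalizedPosDef

theorem IsNormalizedPosDef.comp_continuousLinearMap {E H : Type*} [NormedAddCommGroup E]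
    [NormedSpace ℝ E] [NormedAddCommGroup H] [NormedSpace ℝ H] {f : H → ℂ}
    (hf : IsNormalizedPosDef f) (A : E →L[ℝ] H) : IsNormalizedPosDef fun a => f (A a) where
  continuous := hf.continuous.comp A.continuous
  map_zero := by simp [hf.map_zero]
  posDef n ξ c := by simpa using hf.posDef n (fun i => A (ξ i)) c

/-! ### A law on the space of real sequences. -/

section SequenceLaw

variable {H : Type*} [NormedAddCommGroup H] [NormedSpace ℝ H] {f : H → ℂ}

/-- Bochner's theorem for `f` pulled back along `a ↦ ∑ a i • d i`, pushed forward by padding with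
zeros. The padding puts all these laws on one space, where tightness is easy to check. -/
theorem exists_finite_sequence_law (hf : IsNormalizedPosDef f) (d : ℕ → H) (n : ℕ) :
    ∃ μ : ProbabilityMeasure (ℕ → ℝ),
      (∀ a : ℕ → ℝ, ∫ x, Complex.exp (((∑ k ∈ Finset.range n, a k * x k : ℝ) : ℂ) * Complex.I)
        ∂(μ : Measure (ℕ → ℝ)) = f (∑ k ∈ Finset.range n, a k • d k)) ∧
      ∀ k, n ≤ k → ∀ᵐ x ∂(μ : Measure (ℕ → ℝ)), x k = 0 := by
  let A : EuclideanSpace ℝ (Fin n) →L[ℝ] H :=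
    ∑ i : Fin n, (EuclideanSpace.proj (𝕜 := ℝ) i).smulRight (d i)
  obtain ⟨ν, hν⟩ := (hf.comp_continuousLinearMap A).exists_charFun_eq
  let e : EuclideanSpace ℝ (Fin n) → ℕ → ℝ := fun x k => if h : k < n then x ⟨k, h⟩ else 0
  have hek : ∀ (x : EuclideanSpace ℝ (Fin n)) (i : Fin n), e x i = x i := fun x i => by simp [e]
  have hem : Measurable e := by
    refine measurable_pi_lambda _ fun k => ?_
    by_cases h : k < n
    · simp only [e, h, dif_pos]; fun_prop
    · simp only [e, h, dif_neg, not_false_eq_true]; fun_prop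
  refine ⟨ν.map hem.aemeasurable, fun a => ?_, fun k hk => ?_⟩
  · rw [ProbabilityMeasure.toMeasure_map, integral_map hem.aemeasurable
      (by fun_prop : Continuous fun x : ℕ → ℝ => Complex.exp
        (((∑ k ∈ Finset.range n, a k * x k : ℝ) : ℂ) * Complex.I)).aestronglyMeasurable]
    have h := hν (WithLp.toLp 2 fun i => a i)
    have hA : ∀ x : EuclideanSpace ℝ (Fin n), A x = ∑ i, x i • d i := fun x => by simp [A]
    rw [charFun_apply, hA] at h
    rw [Finset.sum_range]
    refine Eq.trans ?_ h
    congr 1; ext x; congr 3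
    rw [PiLp.inner_apply, Finset.sum_range]
    refine Finset.sum_congr rfl fun i _ => ?_
    rw [hek]
    simp
  · rw [ProbabilityMeasure.toMeasure_map, ae_map_iff hem.aemeasurable
      (measurableSet_eq_fun (measurable_pi_apply k) measurable_const)]
    exact ae_of_all _ fun x => by simp [e, hk]

theorem exists_norm_gt_le (μ : Measure ℝ) [IsFiniteMeasure μ] {η : ENNReal} (hη : 0 < η) :
    ∃ R : ℝ, μ {x | R < ‖x‖} ≤ η := by
  have h := tendsto_measure_norm_gt_of_isTightMeasureSet (isTightMeasureSet_singleton (μ := μ))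
  obtain ⟨R, hR⟩ := (h.eventually (gt_mem_nhds hη)).exists
  exact ⟨R, by simpa using hR.le⟩

/-- A continuous positive definite function on `H` and a sequence in `H` determine a law on the
space of real sequences. -/
theorem exists_sequence_law (hf : IsNormalizedPosDef f) (d : ℕ → H) :
    ∃ μ : ProbabilityMeasure (ℕ → ℝ), ∀ (s : Finset ℕ) (a : ℕ → ℝ),
      ∫ x, Complex.exp (((∑ k ∈ s, a k * x k : ℝ) : ℂ) * Complex.I) ∂(μ : Measure (ℕ → ℝ))
        = f (∑ k ∈ s, a k • d k) := by
  choose S hS hS0 using exists_finite_sequence_law hf d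
  have hsub : ∀ (s : Finset ℕ) (a : ℕ → ℝ) (n : ℕ), s ⊆ Finset.range n →
      ∫ x, Complex.exp (((∑ k ∈ s, a k * x k : ℝ) : ℂ) * Complex.I) ∂(S n : Measure (ℕ → ℝ))
        = f (∑ k ∈ s, a k • d k) := by
    intro s a n hs
    have h := hS n fun k => if k ∈ s then a k else 0
    simp only [ite_mul, zero_mul, ite_smul, zero_smul] at h
    simp_rw [← Finset.sum_filter, Finset.filter_mem_eq_inter, Finset.inter_eq_right.2 hs] at h
    exact h
  have hmarg : ∀ k n, k < n → (S n : Measure (ℕ → ℝ)).map (fun x => x k)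
      = (S (k + 1) : Measure (ℕ → ℝ)).map (fun x => x k) := by
    intro k n hkn
    have hp : ∀ n, IsProbabilityMeasure ((S n : Measure (ℕ → ℝ)).map (fun x => x k)) := fun n =>
      Measure.isProbabilityMeasure_map (measurable_pi_apply k).aemeasurable
    have h1 : ∀ n, k < n → ∀ t, charFun ((S n : Measure (ℕ → ℝ)).map (fun x => x k)) t
        = f (t • d k) := by
      intro n hn t
      rw [charFun_apply, integral_map (measurable_pi_apply k).aemeasurable (by fun_prop)]
      have := hsub {k} (fun _ => t) n (by simpa using hn)
      simpa using this
    exact Measure.ext_of_charFun (funext fun t => by rw [h1 n hkn, h1 _ (Nat.lt_succ_self k)])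
  -- The `k`-th marginal is the same for all `n > k` and is concentrated at `0` for `n ≤ k`. One
  -- compact interval per coordinate therefore works for all `n`, and the product of the intervals
  -- is compact.
  have htight : IsTightMeasureSet (Set.range fun n => (S n : Measure (ℕ → ℝ))) := by
    rw [isTightMeasureSet_iff_exists_isCompact_measure_compl_le]
    intro ε hε
    obtain ⟨η, hη, hsum⟩ := ENNReal.exists_pos_sum_of_countable' hε.ne' ℕ
    choose R hR using fun k =>
      exists_norm_gt_le ((S (k + 1) : Measure (ℕ → ℝ)).map (fun x => x k)) (hη k)
    refine ⟨Set.univ.pi fun k => Set.Icc (-|R k|) |R k|,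
      isCompact_univ_pi fun k => isCompact_Icc, ?_⟩
    rintro _ ⟨n, rfl⟩
    have hcov : (Set.univ.pi fun k => Set.Icc (-|R k|) |R k|)ᶜ
        ⊆ ⋃ k, {x : ℕ → ℝ | |R k| < ‖x k‖} := by
      intro x hx
      simp only [Set.mem_compl_iff, Set.mem_univ_pi, not_forall, ← abs_le, Set.mem_Icc,
        not_le] at hx
      simpa using hx
    have hmeas : ∀ r : ℝ, MeasurableSet {y : ℝ | r < ‖y‖} := fun r =>
      measurableSet_lt measurable_const measurable_norm
    refine (measure_mono hcov).trans ((measure_iUnion_le _).trans (le_trans ?_ hsum.le))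
    refine ENNReal.tsum_le_tsum fun k => ?_
    rcases lt_or_ge k n with hk | hk
    · have h2 := hR k
      rw [← hmarg k n hk, Measure.map_apply (measurable_pi_apply k) (hmeas _)] at h2
      refine le_trans (measure_mono fun x hx => ?_) h2
      exact (le_abs_self (R k)).trans_lt hx
    · have h3 : (S n : Measure (ℕ → ℝ)) {x | |R k| < ‖x k‖} = 0 := by
        rw [measure_eq_zero_iff_ae_notMem]
        filter_upwards [hS0 n k hk] with x hx
        simp [hx]
      exact h3.le.trans zero_le
  obtain ⟨μ, hμ⟩ := exists_probabilityMeasure_of_isTight S htight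
  refine ⟨μ, fun s a => hμ _ (by fun_prop) _ ?_⟩
  obtain ⟨N, hN⟩ := s.exists_nat_subset_range
  refine tendsto_const_nhds.congr' ?_
  filter_upwards [eventually_ge_atTop N] with n hn
  exact (hsub s a n (hN.trans (Finset.range_mono hn))).symm

end SequenceLaw

/-! ### Tail bounds and a.e. linearity of the process. -/

section Tail

variable {X : Type*} [MeasurableSpace X]

/-- A law with characteristic function `1` is the Dirac mass at `0`. This is the source of the a.e.
identities between process variables. -/
theorem ae_eq_zero_of_integral_exp_eq_one {m : Measure X} [IsProbabilityMeasure m] {Y : X → ℝ}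
    (hY : Measurable Y)
    (h : ∀ s : ℝ, ∫ x, Complex.exp (((s * Y x : ℝ) : ℂ) * Complex.I) ∂m = 1) : Y =ᵐ[m] 0 := by
  have hp : IsProbabilityMeasure (m.map Y) := Measure.isProbabilityMeasure_map hY.aemeasurable
  have hmap : m.map Y = Measure.dirac 0 := by
    refine Measure.ext_of_charFun (funext fun t => ?_)
    rw [charFun_dirac, charFun_apply, integral_map hY.aemeasurable (by fun_prop)]
    simpa using h t
  have h0 : ∀ᵐ y ∂(m.map Y), y = 0 := by
    rw [hmap, ae_dirac_eq]
    simp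
  exact ae_of_ae_map hY.aemeasurable h0

theorem measureReal_abs_gt_le_of_charFun {m : Measure X} [IsProbabilityMeasure m] {Y : X → ℝ}
    (hY : Measurable Y) {r c : ℝ} (hr : 0 < r)
    (h : ∀ t : ℝ, |t| ≤ 2 / r →
      ‖1 - ∫ x, Complex.exp (((t * Y x : ℝ) : ℂ) * Complex.I) ∂m‖ ≤ c) :
    m.real {x | r < |Y x|} ≤ 2 * c := by
  have hp : IsProbabilityMeasure (m.map Y) := Measure.isProbabilityMeasure_map hY.aemeasurable
  have h1 := measureReal_abs_gt_le_integral_charFun (μ := m.map Y) hr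
  rw [map_measureReal_apply hY (measurableSet_lt measurable_const measurable_abs)] at h1
  have h2 : ‖∫ t in (-2 * r⁻¹)..(2 * r⁻¹), 1 - charFun (m.map Y) t‖
      ≤ c * |2 * r⁻¹ - -2 * r⁻¹| := by
    refine intervalIntegral.norm_integral_le_of_norm_le_const fun t ht => ?_
    have hle : -2 * r⁻¹ ≤ 2 * r⁻¹ := by
      have := inv_pos.2 hr
      linarith
    rw [Set.uIoc_of_le hle] at ht
    have ht' : |t| ≤ 2 / r := by
      rw [div_eq_mul_inv, abs_le]
      constructor <;> linarith [ht.1, ht.2]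
    rw [charFun_apply_real, integral_map hY.aemeasurable (by fun_prop)]
    simpa using h t ht'
  rw [show 2 * r⁻¹ - -2 * r⁻¹ = 4 * r⁻¹ by ring, abs_of_pos (by positivity)] at h2
  refine h1.trans ?_
  calc _ ≤ 2⁻¹ * r * (c * (4 * r⁻¹)) := by gcongr
    _ = 2 * c := by field_simp; ring

variable {H : Type*} [NormedAddCommGroup H] [NormedSpace ℝ H] {f : H → ℂ}

/-- For small `ξ`, continuity of `f` keeps `f (t • ξ)` near `1` for `|t| ≤ 2 / ε`, and the
truncation inequality converts this into a tail bound. The same `δ` serves all `m` and `Y`. -/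
theorem IsNormalizedPosDef.exists_tail_bound (hf : IsNormalizedPosDef f) (X : Type*)
    [MeasurableSpace X] {ε : ℝ} (hε : 0 < ε) :
    ∃ δ > 0, ∀ (m : Measure X) [IsProbabilityMeasure m] (Y : X → ℝ) (ξ : H), Measurable Y →
      (∀ t : ℝ, ∫ x, Complex.exp (((t * Y x : ℝ) : ℂ) * Complex.I) ∂m = f (t • ξ)) →
      ‖ξ‖ < δ → m.real {x | ε < |Y x|} ≤ ε := by
  obtain ⟨ρ, hρ, h⟩ := Metric.continuousAt_iff.1 hf.continuous.continuousAt (ε / 2) (half_pos hε)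
  refine ⟨ρ * ε / 2, by positivity, fun m _ Y ξ hY hlaw hξ => ?_⟩
  refine (measureReal_abs_gt_le_of_charFun hY hε (c := ε / 2) fun t ht => ?_).trans_eq (by ring)
  rw [hlaw, ← hf.map_zero, ← dist_eq_norm, dist_comm]
  refine (h ?_).le
  rw [dist_zero_right, norm_smul, Real.norm_eq_abs]
  calc |t| * ‖ξ‖ ≤ 2 / ε * ‖ξ‖ := by gcongr
    _ < 2 / ε * (ρ * ε / 2) := by gcongr
    _ = ρ := by field_simp

end Tail

/-- `L` is a measurable version of the generalised process on `H` with characteristic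
functional `f`. -/
structure IsLinearProcess {H X : Type*} [NormedAddCommGroup H] [NormedSpace ℝ H]
    [MeasurableSpace X] (f : H → ℂ) (m : Measure X) (L : H → X → ℝ) : Prop where
  measurable : ∀ ξ, Measurable (L ξ)
  law : ∀ {ι : Type} [Fintype ι] (ξ : ι → H) (t : ι → ℝ),
    ∫ x, Complex.exp (((∑ i, t i * L (ξ i) x : ℝ) : ℂ) * Complex.I) ∂m = f (∑ i, t i • ξ i)

namespace IsLinearProcess

variable {H X : Type*} [NormedAddCommGroup H] [NormedSpace ℝ H] [MeasurableSpace X] {f : H → ℂ}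
  {m : Measure X} {L : H → X → ℝ}

theorem law_single (hL : IsLinearProcess f m L) (ξ : H) (t : ℝ) :
    ∫ x, Complex.exp (((t * L ξ x : ℝ) : ℂ) * Complex.I) ∂m = f (t • ξ) := by
  simpa using hL.law (ι := Unit) (fun _ => ξ) (fun _ => t)

variable [IsProbabilityMeasure m]

/-- With coefficients `s * t i` the law gives `f 0 = 1` for every `s`. Additivity and homogeneity
are special cases, each with its own null set. -/
theorem ae_sum_eq_zero (hL : IsLinearProcess f m L) (hf0 : f 0 = 1) {ι : Type} [Fintype ι]
    {ξ : ι → H} {t : ι → ℝ} (h : ∑ i, t i • ξ i = 0) : ∀ᵐ x ∂m, ∑ i, t i * L (ξ i) x = 0 := by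
  have hm := hL.measurable
  refine ae_eq_zero_of_integral_exp_eq_one (Y := fun x => ∑ i, t i * L (ξ i) x) (by fun_prop)
    fun s => ?_
  have := hL.law ξ fun i => s * t i
  simpa only [mul_smul, ← Finset.smul_sum, h, smul_zero, hf0, mul_assoc, ← Finset.mul_sum]
    using this

theorem map_add (hL : IsLinearProcess f m L) (hf0 : f 0 = 1) (ξ η : H) :
    L (ξ + η) =ᵐ[m] fun x => L ξ x + L η x := by
  have := hL.ae_sum_eq_zero hf0 (ξ := ![ξ + η, ξ, η]) (t := ![1, -1, -1])
    (by simp [Fin.sum_univ_three])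
  filter_upwards [this] with x hx
  simp [Fin.sum_univ_three] at hx
  linarith

theorem map_smul (hL : IsLinearProcess f m L) (hf0 : f 0 = 1) (c : ℝ) (ξ : H) :
    L (c • ξ) =ᵐ[m] fun x => c * L ξ x := by
  have := hL.ae_sum_eq_zero hf0 (ξ := ![c • ξ, ξ]) (t := ![1, -c]) (by simp)
  filter_upwards [this] with x hx
  simp at hx
  linarith

theorem map_sub (hL : IsLinearProcess f m L) (hf0 : f 0 = 1) (ξ η : H) :
    L (ξ - η) =ᵐ[m] fun x => L ξ x - L η x := by
  have := hL.ae_sum_eq_zero hf0 (ξ := ![ξ - η, ξ, η]) (t := ![1, -1, 1])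
    (by simp only [Fin.sum_univ_three]; simp; abel)
  filter_upwards [this] with x hx
  simp [Fin.sum_univ_three] at hx
  linarith

theorem exists_tail_bound (hL : IsLinearProcess f m L) (hf : IsNormalizedPosDef f) {ε : ℝ}
    (hε : 0 < ε) : ∃ δ > 0, ∀ ξ, ‖ξ‖ < δ → m.real {x | ε < |L ξ x|} ≤ ε := by
  obtain ⟨δ, hδ, h⟩ := hf.exists_tail_bound X hε
  exact ⟨δ, hδ, fun ξ hξ => h m (L ξ) ξ (hL.measurable ξ) (hL.law_single ξ) hξ⟩

end IsLinearProcess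

/-! ### Construction of the process as a.e. limits of coordinates. -/

section Sequence

variable {H : Type*} [NormedAddCommGroup H] [NormedSpace ℝ H]

/-- The coordinates on the space of real sequences have the joint law prescribed by `f` at the
points `d k`. -/
def HasSequenceLaw (f : H → ℂ) (d : ℕ → H) (m : Measure (ℕ → ℝ)) : Prop :=
  ∀ (s : Finset ℕ) (a : ℕ → ℝ),
    ∫ x, Complex.exp (((∑ k ∈ s, a k * x k : ℝ) : ℂ) * Complex.I) ∂m = f (∑ k ∈ s, a k • d k)

/-- `Y` is an almost sure limit of coordinates `x (k n)` with `d (k n) → ξ`. -/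
def IsCoordLimit {H : Type*} [NormedAddCommGroup H] (d : ℕ → H) (m : Measure (ℕ → ℝ)) (ξ : H) (Y : (ℕ → ℝ) → ℝ) : Prop :=
  Measurable Y ∧ ∃ k : ℕ → ℕ, Tendsto (fun n => d (k n)) atTop (𝓝 ξ) ∧
    ∀ᵐ x ∂m, Tendsto (fun n => x (k n)) atTop (𝓝 (Y x))

variable {f : H → ℂ} {d : ℕ → H} {m : Measure (ℕ → ℝ)}

theorem isCoordLimit_coord {H : Type*} [NormedAddCommGroup H] {d : ℕ → H}
    {m : Measure (ℕ → ℝ)} (k : ℕ) : IsCoordLimit d m (d k) fun x => x k :=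
  ⟨measurable_pi_apply k, fun _ => k, tendsto_const_nhds, ae_of_all _ fun _ => tendsto_const_nhds⟩

theorem sum_fiber_smul {ι M : Type*} [Fintype ι] [AddCommGroup M] [Module ℝ M] (k : ι → ℕ)
    (t : ι → ℝ) (v : ℕ → M) :
    ∑ l ∈ Finset.univ.image k, (∑ i with k i = l, t i) • v l = ∑ i, t i • v (k i) := by
  rw [← Finset.sum_fiberwise_of_maps_to (g := k) (t := Finset.univ.image k)
    (fun i _ => Finset.mem_image_of_mem _ (Finset.mem_univ i))]
  refine Finset.sum_congr rfl fun l _ => ?_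
  rw [Finset.sum_smul]
  refine Finset.sum_congr rfl fun i hi => ?_
  rw [(Finset.mem_filter.1 hi).2]

theorem HasSequenceLaw.law_family (h : HasSequenceLaw f d m) {ι : Type} [Fintype ι] (k : ι → ℕ)
    (t : ι → ℝ) : ∫ x, Complex.exp (((∑ i, t i * x (k i) : ℝ) : ℂ) * Complex.I) ∂m
      = f (∑ i, t i • d (k i)) := by
  have h1 := h (Finset.univ.image k) fun l => ∑ i with k i = l, t i
  rw [sum_fiber_smul k t d] at h1
  rw [← h1]
  congr 1; ext x; congr 3
  exact (sum_fiber_smul k t x).symm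

variable [IsProbabilityMeasure m]

theorem HasSequenceLaw.law_coordLimit (h : HasSequenceLaw f d m) (hf : Continuous f) {ι : Type}
    [Fintype ι] {ξ : ι → H} {Y : ι → (ℕ → ℝ) → ℝ} (hY : ∀ i, IsCoordLimit d m (ξ i) (Y i))
    (t : ι → ℝ) : ∫ x, Complex.exp (((∑ i, t i * Y i x : ℝ) : ℂ) * Complex.I) ∂m
      = f (∑ i, t i • ξ i) := by
  choose hm k hk hlim using hY
  have h1 : Tendsto (fun n => ∫ x, Complex.exp (((∑ i, t i * x (k i n) : ℝ) : ℂ) * Complex.I) ∂m)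
      atTop (𝓝 (∫ x, Complex.exp (((∑ i, t i * Y i x : ℝ) : ℂ) * Complex.I) ∂m)) := by
    refine tendsto_integral_of_dominated_convergence (fun _ => 1) ?_ (integrable_const _) ?_ ?_
    · exact fun n => (by fun_prop : Continuous fun x : ℕ → ℝ =>
        Complex.exp (((∑ i, t i * x (k i n) : ℝ) : ℂ) * Complex.I)).aestronglyMeasurable
    · exact fun n => ae_of_all _ fun x => (Complex.norm_exp_ofReal_mul_I _).le
    · filter_upwards [ae_all_iff.2 hlim] with x hx
      have hc : Continuous fun y : ℝ => Complex.exp ((y : ℂ) * Complex.I) := by fun_prop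
      exact (hc.tendsto _).comp (tendsto_finsetSum _ fun i _ => (hx i).const_mul (t i))
  have h2 : Tendsto (fun n => f (∑ i, t i • d (k i n))) atTop (𝓝 (f (∑ i, t i • ξ i))) :=
    (hf.tendsto _).comp (tendsto_finsetSum _ fun i _ => (hk i).const_smul (t i))
  simp_rw [h.law_family] at h1
  exact tendsto_nhds_unique h1 h2

/-- Approximate `ξ` so fast that the `n`-th increment exceeds `2⁻ⁿ` with probability at most `2⁻ⁿ`;
Borel–Cantelli makes the increments a.e. summable. -/
theorem HasSequenceLaw.exists_coordLimit (h : HasSequenceLaw f d m) (hf : IsNormalizedPosDef f)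
    (hd : DenseRange d) (ξ : H) : ∃ Y, IsCoordLimit d m ξ Y := by
  have hε : ∀ n : ℕ, (0 : ℝ) < (1 / 2) ^ n := fun n => by positivity
  choose δ hδ htail using fun n => hf.exists_tail_bound (ℕ → ℝ) (hε n)
  -- Each point ends one increment and starts the next, hence both `δ n` and `δ (n - 1)`; at `n = 0`
  -- truncated subtraction merely repeats `δ 0`.
  have hk : ∀ n, ∃ k, dist ξ (d k) < min ((1 / 2) ^ n) (min (δ n / 2) (δ (n - 1) / 2)) := fun n =>
    Metric.denseRange_iff.1 hd ξ _ (lt_min (hε n) (lt_min (half_pos (hδ _)) (half_pos (hδ _))))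
  choose k hk using hk
  have hkξ : Tendsto (fun n => d (k n)) atTop (𝓝 ξ) := by
    rw [tendsto_iff_dist_tendsto_zero]
    refine squeeze_zero (fun _ => dist_nonneg)
      (fun n => (dist_comm _ _).trans_le ((hk n).le.trans (min_le_left _ _))) ?_
    exact tendsto_pow_atTop_nhds_zero_of_lt_one (by norm_num) (by norm_num)
  have hstep : ∀ n, m.real {x : ℕ → ℝ | (1 / 2 : ℝ) ^ n < |x (k n) - x (k (n + 1))|}
      ≤ (1 / 2) ^ n := by
    intro n
    refine htail n m (fun x => x (k n) - x (k (n + 1))) (d (k n) - d (k (n + 1))) (by fun_prop)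
      (fun t => ?_) ?_
    · have := h.law_family (ι := Fin 2) ![k n, k (n + 1)] ![t, -t]
      simp only [Fin.sum_univ_two, Matrix.cons_val_zero, Matrix.cons_val_one] at this
      rw [smul_sub, sub_eq_add_neg, ← neg_smul, ← this]
      congr 1; ext x; congr 3; ring
    · rw [← dist_eq_norm]
      have h1 := (hk n).trans_le ((min_le_right _ _).trans (min_le_left _ _))
      have h2 := (hk (n + 1)).trans_le ((min_le_right _ _).trans (min_le_right _ _))
      rw [Nat.add_sub_cancel] at h2
      have := dist_triangle_left (d (k n)) (d (k (n + 1))) ξ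
      linarith
  have hsum : ∑' n, m {x : ℕ → ℝ | (1 / 2 : ℝ) ^ n < |x (k n) - x (k (n + 1))|} ≠ ⊤ := by
    have hs : Summable fun n : ℕ => (1 / 2 : ℝ) ^ n := summable_geometric_two
    refine ne_top_of_le_ne_top hs.tsum_ofReal_ne_top (ENNReal.tsum_le_tsum fun n => ?_)
    rw [← ofReal_measureReal]
    exact ENNReal.ofReal_le_ofReal (hstep n)
  have hconv : ∀ᵐ x ∂m, ∃ l, Tendsto (fun n => x (k n)) atTop (𝓝 l) := by
    filter_upwards [ae_eventually_notMem hsum] with x hx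
    refine cauchySeq_tendsto_of_complete (cauchySeq_of_summable_dist ?_)
    refine Summable.of_norm_bounded_eventually_nat summable_geometric_two ?_
    filter_upwards [hx] with n hn
    simpa [Real.dist_eq] using hn
  obtain ⟨Y, hYm, hY⟩ := measurable_limit_of_tendsto_metrizable_ae
    (fun n => (measurable_pi_apply (k n)).aemeasurable) hconv
  exact ⟨Y, hYm, k, hkξ, hY⟩

theorem IsCoordLimit.isLinearProcess (h : HasSequenceLaw f d m) (hf : Continuous f)
    {L : H → (ℕ → ℝ) → ℝ} (hL : ∀ ξ, IsCoordLimit d m ξ (L ξ)) : IsLinearProcess f m L where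
  measurable ξ := (hL ξ).1
  law ξ t := h.law_coordLimit hf (fun i => hL (ξ i)) t

theorem IsCoordLimit.ae_eq (h : HasSequenceLaw f d m) (hf : IsNormalizedPosDef f) {ξ : H}
    {Y Y' : (ℕ → ℝ) → ℝ} (hY : IsCoordLimit d m ξ Y) (hY' : IsCoordLimit d m ξ Y') :
    Y =ᵐ[m] Y' := by
  have h0 := ae_eq_zero_of_integral_exp_eq_one (m := m) (Y := fun x => Y x - Y' x)
    (hY.1.sub hY'.1) fun s => by
      have := h.law_coordLimit hf.continuous (ι := Fin 2) (ξ := ![ξ, ξ]) (Y := ![Y, Y'])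
        (by simp [Fin.forall_fin_two, hY, hY']) ![s, -s]
      simp only [Fin.sum_univ_two, Matrix.cons_val_zero, Matrix.cons_val_one, neg_smul,
        add_neg_cancel, hf.map_zero] at this
      rw [← this]
      congr 1; ext x; congr 3; ring
  filter_upwards [h0] with x hx
  exact sub_eq_zero.1 hx

end Sequence

/-! ### Gaussian averaging: sums of squares are bounded in probability. -/

section GaussianAverage

open ProbabilityTheory

variable {H : Type*} [NormedAddCommGroup H] [InnerProductSpace ℝ H] {ι : Type*} [Fintype ι]

theorem integrable_mul_stdGaussian (i j : ι) :
    Integrable (fun g : EuclideanSpace ℝ ι => g i * g j) (stdGaussian (EuclideanSpace ℝ ι)) := by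
  have h : ∀ i : ι, MemLp (fun g : EuclideanSpace ℝ ι => g i) 2
      (stdGaussian (EuclideanSpace ℝ ι)) := fun i =>
    IsGaussian.memLp_dual _ (EuclideanSpace.proj (𝕜 := ℝ) i) 2 (by simp)
  exact (h i).integrable_mul (h j)

theorem integral_mul_stdGaussian [DecidableEq ι] (i j : ι) :
    ∫ g : EuclideanSpace ℝ ι, g i * g j ∂(stdGaussian (EuclideanSpace ℝ ι))
      = if i = j then 1 else 0 := by
  have h := covarianceBilin_apply (μ := stdGaussian (EuclideanSpace ℝ ι))
    IsGaussian.memLp_two_id (EuclideanSpace.single i (1 : ℝ)) (EuclideanSpace.single j (1 : ℝ))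
  have h0 : ∫ x, id x ∂(stdGaussian (EuclideanSpace ℝ ι)) = 0 := integral_id_stdGaussian
  rw [covarianceBilin_stdGaussian, h0, innerSL_apply_apply] at h
  simpa [EuclideanSpace.inner_single_left, eq_comm] using h.symm

theorem norm_sum_smul_sq (g : ι → ℝ) (ξ : ι → H) :
    ‖∑ i, g i • ξ i‖ ^ 2 = ∑ i, ∑ j, (g i * g j) * inner ℝ (ξ i) (ξ j) := by
  rw [← real_inner_self_eq_norm_sq, sum_inner]
  refine Finset.sum_congr rfl fun i _ => ?_
  rw [inner_sum]
  refine Finset.sum_congr rfl fun j _ => ?_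
  rw [real_inner_smul_left, real_inner_smul_right]
  ring

theorem integrable_norm_sum_smul_sq (ξ : ι → H) :
    Integrable (fun g : EuclideanSpace ℝ ι => ‖∑ i, g i • ξ i‖ ^ 2)
      (stdGaussian (EuclideanSpace ℝ ι)) := by
  simp_rw [norm_sum_smul_sq]
  exact integrable_finsetSum _ fun i _ => integrable_finsetSum _ fun j _ =>
    (integrable_mul_stdGaussian i j).mul_const _

theorem integral_norm_sum_smul_sq (ξ : ι → H) :
    ∫ g : EuclideanSpace ℝ ι, ‖∑ i, g i • ξ i‖ ^ 2 ∂(stdGaussian (EuclideanSpace ℝ ι))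
      = ∑ i, ‖ξ i‖ ^ 2 := by
  classical
  simp_rw [norm_sum_smul_sq]
  rw [integral_finsetSum _ fun i _ => integrable_finsetSum _ fun j _ =>
    (integrable_mul_stdGaussian i j).mul_const _]
  refine Finset.sum_congr rfl fun i _ => ?_
  rw [integral_finsetSum _ fun j _ => (integrable_mul_stdGaussian i j).mul_const _]
  simp_rw [integral_mul_const, integral_mul_stdGaussian]
  simp

end GaussianAverage

namespace IsLinearProcess

variable {H X : Type*} [NormedAddCommGroup H] [InnerProductSpace ℝ H] [MeasurableSpace X]
  {f : H → ℂ} {m : Measure X} {L : H → X → ℝ} [IsProbabilityMeasure m]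

-- For fixed `x`, the variable `∑ t * g i * L (ξ i) x` is centred Gaussian with variance `t² ∑ L (ξ
-- i) x²`. Fubini compares its characteristic function with the law of the process at fixed `g`.
open ProbabilityTheory in
theorem integral_exp_neg_sum_sq (hL : IsLinearProcess f m L) {ι : Type} [Fintype ι] (ξ : ι → H)
    (t : ℝ) : ((∫ x, Real.exp (-(t ^ 2 * ∑ i, L (ξ i) x ^ 2) / 2) ∂m : ℝ) : ℂ)
      = ∫ g, f (∑ i, (t * g i) • ξ i) ∂(stdGaussian (EuclideanSpace ℝ ι)) := by
  have hm := hL.measurable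
  have h1 : ∀ g : EuclideanSpace ℝ ι, f (∑ i, (t * g i) • ξ i)
      = ∫ x, Complex.exp (((∑ i, t * g i * L (ξ i) x : ℝ) : ℂ) * Complex.I) ∂m := fun g =>
    (hL.law ξ fun i => t * g i).symm
  simp_rw [h1]
  rw [integral_integral_swap]
  · rw [← integral_complex_ofReal]
    refine integral_congr_ae (ae_of_all _ fun x => ?_)
    have h2 := charFun_stdGaussian (E := EuclideanSpace ℝ ι)
      (WithLp.toLp 2 fun i => t * L (ξ i) x)
    rw [charFun_apply] at h2
    have h3 : ∀ g : EuclideanSpace ℝ ι,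
        inner ℝ g (WithLp.toLp 2 fun i => t * L (ξ i) x) = ∑ i, t * g i * L (ξ i) x := by
      intro g
      rw [PiLp.inner_apply]
      refine Finset.sum_congr rfl fun i _ => ?_
      simp only [RCLike.inner_apply, conj_trivial]
      ring
    simp_rw [h3] at h2
    dsimp only
    rw [h2, ← Complex.ofReal_pow, EuclideanSpace.norm_sq_eq]
    simp only [Real.norm_eq_abs, sq_abs, mul_pow, ← Finset.mul_sum]
    push_cast
    rfl
  · refine Integrable.of_bound (C := 1) ?_ (ae_of_all _ fun z =>
      (Complex.norm_exp_ofReal_mul_I _).le)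
    refine Measurable.aestronglyMeasurable ?_
    unfold Function.uncurry
    fun_prop

/-- Averaging over Gaussian coefficients: sums of squares of the process over families with
`∑ ‖ξ i‖ ^ 2 ≤ 1` are uniformly bounded in probability. -/
theorem exists_sum_sq_tail_bound (hL : IsLinearProcess f m L) (hf : IsNormalizedPosDef f) {η : ℝ}
    (hη : 0 < η) : ∃ R > 0, ∀ {ι : Type} [Fintype ι] (ξ : ι → H), ∑ i, ‖ξ i‖ ^ 2 ≤ 1 →
      m.real {x | R < ∑ i, L (ξ i) x ^ 2} ≤ η := by
  have hm := hL.measurable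
  have hε : 0 < η / 4 := by positivity
  set ε := η / 4 with hεdef
  obtain ⟨ρ, hρ, h⟩ := Metric.continuousAt_iff.1 (hf.continuous.continuousAt (x := 0)) ε hε
  -- Inside the `ρ`-ball this is continuity at `0`; outside it, the quadratic term is at least `2`
  -- and `Re f ≥ -1`.
  have hre : ∀ ζ : H, 1 - ε - 2 / ρ ^ 2 * ‖ζ‖ ^ 2 ≤ (f ζ).re := by
    intro ζ
    rcases lt_or_ge ‖ζ‖ ρ with hζ | hζ
    · have h1 := h (x := ζ) (by simpa using hζ)
      rw [hf.map_zero, dist_comm, dist_eq_norm] at h1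
      have h2 := (Complex.re_le_norm (1 - f ζ)).trans h1.le
      simp at h2
      have : 0 ≤ 2 / ρ ^ 2 * ‖ζ‖ ^ 2 := by positivity
      linarith
    · have h1 := (abs_le.1 ((Complex.abs_re_le_norm _).trans (hf.norm_le_one ζ))).1
      have h2 : 2 ≤ 2 / ρ ^ 2 * ‖ζ‖ ^ 2 := by
        rw [div_mul_eq_mul_div, le_div_iff₀ (by positivity)]
        gcongr
      linarith
  set t : ℝ := ρ * √(ε / 2) with ht
  have htpos : 0 < t := by positivity
  have ht2 : 2 / ρ ^ 2 * t ^ 2 = ε := by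
    rw [ht, mul_pow, Real.sq_sqrt (by positivity)]
    field_simp
  -- Above this threshold the exponential is at most `1/e ≤ 1/2`. Its mean is thus at most `1 -
  -- P/2`, with `P` the tail probability, and at least `1 - 2ε` by the choice of `t`; so `P ≤ 4ε =
  -- η`.
  refine ⟨2 / t ^ 2, by positivity, fun {ι} _ ξ hξ => ?_⟩
  have hfc := hf.continuous
  have hint : Integrable (fun g : EuclideanSpace ℝ ι => f (∑ i, (t * g i) • ξ i))
      (ProbabilityTheory.stdGaussian (EuclideanSpace ℝ ι)) :=
    Integrable.of_bound (by fun_prop : Continuous _).aestronglyMeasurable 1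
      (ae_of_all _ fun g => hf.norm_le_one _)
  have hlow : 1 - 2 * ε ≤ ∫ x, Real.exp (-(t ^ 2 * ∑ i, L (ξ i) x ^ 2) / 2) ∂m := by
    have h1 := congrArg Complex.re (hL.integral_exp_neg_sum_sq ξ t)
    rw [Complex.ofReal_re] at h1
    rw [h1, ← RCLike.re_eq_complex_re, ← integral_re hint]
    have h2 : ∫ g : EuclideanSpace ℝ ι, (1 - ε - ε * ‖∑ i, g i • ξ i‖ ^ 2)
        ∂(ProbabilityTheory.stdGaussian (EuclideanSpace ℝ ι)) = 1 - ε - ε * ∑ i, ‖ξ i‖ ^ 2 := by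
      rw [integral_sub (integrable_const _) ((integrable_norm_sum_smul_sq ξ).const_mul _),
        integral_const_mul, integral_norm_sum_smul_sq]
      simp
    have h3 : 1 - 2 * ε ≤ 1 - ε - ε * ∑ i, ‖ξ i‖ ^ 2 := by nlinarith
    refine (h3.trans_eq h2.symm).trans (integral_mono ?_ hint.re fun g => ?_)
    · exact (integrable_const _).sub ((integrable_norm_sum_smul_sq ξ).const_mul _)
    · refine le_trans (le_of_eq ?_) (hre _)
      simp_rw [mul_smul, ← Finset.smul_sum, norm_smul, mul_pow, Real.norm_eq_abs, sq_abs]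
      rw [← mul_assoc, ht2]
  set k : X → ℝ := fun x => ∑ i, L (ξ i) x ^ 2 with hk
  have hkm : Measurable k := by fun_prop
  have hSm : MeasurableSet {x | 2 / t ^ 2 < k x} := measurableSet_lt measurable_const hkm
  have hexpint : Integrable (fun x => Real.exp (-(t ^ 2 * k x) / 2)) m := by
    refine Integrable.of_bound (by fun_prop : Measurable _).aestronglyMeasurable 1
      (ae_of_all _ fun x => ?_)
    rw [Real.norm_of_nonneg (Real.exp_pos _).le, Real.exp_le_one_iff]
    have : 0 ≤ k x := Finset.sum_nonneg fun i _ => sq_nonneg _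
    have : 0 ≤ t ^ 2 * k x := by positivity
    linarith
  have hup : ∫ x, Real.exp (-(t ^ 2 * k x) / 2) ∂m ≤ 1 - 2⁻¹ * m.real {x | 2 / t ^ 2 < k x} := by
    have h1 : ∫ x, (1 - {x | 2 / t ^ 2 < k x}.indicator (fun _ => (2⁻¹ : ℝ)) x) ∂m
        = 1 - 2⁻¹ * m.real {x | 2 / t ^ 2 < k x} := by
      rw [integral_sub (integrable_const _) ((integrable_const _).indicator hSm),
        integral_indicator_const _ hSm]
      simp [mul_comm]
    rw [← h1]
    refine integral_mono hexpint
      ((integrable_const _).sub ((integrable_const _).indicator hSm)) fun x => ?_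
    have hk0 : 0 ≤ k x := Finset.sum_nonneg fun i _ => sq_nonneg _
    by_cases hx : 2 / t ^ 2 < k x
    · simp only [Set.indicator, Set.mem_ofPred_eq, hx, if_true]
      have h2 : 1 ≤ t ^ 2 * k x / 2 := by
        rw [div_lt_iff₀ (by positivity)] at hx
        linarith
      have h3 : Real.exp (-(t ^ 2 * k x) / 2) ≤ Real.exp (-1) :=
        Real.exp_le_exp.2 (by linarith)
      have h4 : Real.exp (-1) ≤ 2⁻¹ := by
        rw [Real.exp_neg]
        refine inv_anti₀ (by norm_num) ?_
        have := Real.add_one_le_exp 1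
        linarith
      linarith
    · simp only [Set.indicator, Set.mem_ofPred_eq, hx, if_false, sub_zero]
      rw [Real.exp_le_one_iff]
      have : 0 ≤ t ^ 2 * k x := by positivity
      linarith
  linarith

end IsLinearProcess

/-! ### Weights by Hahn–Banach separation. -/

namespace IsLinearProcess

variable {H X : Type*} [NormedAddCommGroup H] [InnerProductSpace ℝ H] [MeasurableSpace X]
  {f : H → ℂ} {m : Measure X} {L : H → X → ℝ}

/-- The square-integrable functions dominated by some `∑ (L (ξ i)) ^ 2` with
`∑ ‖ξ i‖ ^ 2 ≤ 1`. -/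
def dominatedSet {H : Type*} [NormedAddCommGroup H] (m : Measure X) (L : H → X → ℝ) : Set (Lp ℝ 2 m) :=
  {g | ∃ (ι : Type) (_ : Fintype ι) (ξ : ι → H), ∑ i, ‖ξ i‖ ^ 2 ≤ 1 ∧
    ∀ᵐ x ∂m, g x ≤ ∑ i, L (ξ i) x ^ 2}

theorem mem_dominatedSet_of_nonpos {H : Type*} [NormedAddCommGroup H] {L : H → X → ℝ}
    {g : Lp ℝ 2 m} (hg : ∀ᵐ x ∂m, g x ≤ 0) :
    g ∈ dominatedSet m L :=
  ⟨Empty, inferInstance, Empty.elim, by simp, by simpa using hg⟩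

variable [IsProbabilityMeasure m]

/-- Scale the two families by `√a` and `√b` and take their disjoint union. Convexity is why finite
families are used instead of single vectors. -/
theorem convex_dominatedSet (hL : IsLinearProcess f m L) (hf0 : f 0 = 1) :
    Convex ℝ (dominatedSet m L) := by
  rintro g ⟨ι, _, ξ, hξ, hg⟩ g' ⟨ι', _, ξ', hξ', hg'⟩ a b ha hb hab
  refine ⟨ι ⊕ ι', inferInstance, Sum.elim (fun i => √a • ξ i) (fun i => √b • ξ' i), ?_, ?_⟩
  · simp only [Fintype.sum_sum_type, Sum.elim_inl, Sum.elim_inr, norm_smul, mul_pow,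
      Real.norm_eq_abs, sq_abs, Real.sq_sqrt ha, Real.sq_sqrt hb, ← Finset.mul_sum]
    calc _ ≤ a * 1 + b * 1 := by gcongr
      _ = 1 := by rw [mul_one, mul_one, hab]
  · have h1 := ae_all_iff.2 fun i => hL.map_smul hf0 (√a) (ξ i)
    have h2 := ae_all_iff.2 fun i => hL.map_smul hf0 (√b) (ξ' i)
    filter_upwards [hg, hg', h1, h2, Lp.coeFn_add (a • g) (b • g'), Lp.coeFn_smul a g,
      Lp.coeFn_smul b g'] with x hx hx' h1 h2 e1 e2 e3
    rw [e1, Pi.add_apply, e2, e3]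
    simp only [Fintype.sum_sum_type, Sum.elim_inl, Sum.elim_inr, h1, h2, mul_pow,
      Real.sq_sqrt ha, Real.sq_sqrt hb, ← Finset.mul_sum, Pi.smul_apply, smul_eq_mul]
    gcongr

/-- A dominated function is at most `R` off a set of measure `m E / 4`, so on most of `E` it stays
at distance at least `1` from `R + 1`. An `L²` distance below `√(m E / 2)` would contradict this. -/
theorem exists_indicator_notMem_closure (hL : IsLinearProcess f m L) (hf : IsNormalizedPosDef f)
    {E : Set X} (hE : MeasurableSet E) (hmE : m E ≠ 0) :
    ∃ R > 0, indicatorConstLp 2 hE (measure_ne_top m E) (R : ℝ) ∉ closure (dominatedSet m L) := by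
  have hm := hL.measurable
  have hmE' : 0 < m.real E := ENNReal.toReal_pos hmE (measure_ne_top m E)
  obtain ⟨R, hR, htail⟩ := hL.exists_sum_sq_tail_bound hf (η := m.real E / 4) (by positivity)
  refine ⟨R + 1, by positivity, fun hcl => ?_⟩
  set p := indicatorConstLp 2 hE (measure_ne_top m E) (R + 1 : ℝ) with hp
  obtain ⟨g, ⟨ι, _, ξ, hξ, hg⟩, hdist⟩ := Metric.mem_closure_iff.1 hcl
    (√(m.real E / 2)) (by positivity)
  have h1 : ∫ x, ((p - g) x) ^ 2 ∂m < m.real E / 2 := by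
    rw [dist_eq_norm] at hdist
    have h2 : ‖p - g‖ ^ 2 = ∫ x, ((p - g) x) ^ 2 ∂m := by
      rw [← real_inner_self_eq_norm_sq, L2.inner_def]
      refine integral_congr_ae (ae_of_all _ fun x => ?_)
      simp [sq]
    rw [← h2]
    exact (Real.lt_sqrt (norm_nonneg _)).1 hdist
  have h2 : m.real {x | 1 ≤ ((p - g) x) ^ 2} ≤ ∫ x, ((p - g) x) ^ 2 ∂m := by
    have := mul_meas_ge_le_integral_of_nonneg (μ := m) (f := fun x => ((p - g) x) ^ 2)
      (ae_of_all _ fun x => sq_nonneg _) (Lp.memLp (p - g)).integrable_sq 1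
    simpa using this
  have h3 := htail ξ hξ
  have h4 : m.real E ≤ m.real ({x | R < ∑ i, L (ξ i) x ^ 2} ∪ {x | 1 ≤ ((p - g) x) ^ 2}) := by
    refine ENNReal.toReal_mono (measure_ne_top _ _) (measure_mono_ae ?_)
    filter_upwards [hg, Lp.coeFn_sub p g, indicatorConstLp_coeFn (p := 2) (hs := hE)
      (hμs := measure_ne_top m E) (c := (R + 1 : ℝ))] with x hx hsub hind hxE
    by_cases hk : R < ∑ i, L (ξ i) x ^ 2
    · exact Or.inl hk
    · right
      change 1 ≤ ((p - g) x) ^ 2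
      rw [hsub, Pi.sub_apply, hp, hind, Set.indicator_of_mem hxE]
      have : 1 ≤ R + 1 - g x := by linarith
      nlinarith
  have h5 := measureReal_union_le (μ := m) {x | R < ∑ i, L (ξ i) x ^ 2} {x | 1 ≤ ((p - g) x) ^ 2}
  linarith

/-- On every non-null set there is a nontrivial weight that makes the process square integrable,
uniformly on the unit ball: separate a multiple of the indicator of the set from
`dominatedSet m L`. -/
theorem exists_weight (hL : IsLinearProcess f m L) (hf : IsNormalizedPosDef f)
    {E : Set X} (hE : MeasurableSet E) (hmE : m E ≠ 0) :
    ∃ (w : X → ℝ) (c : ℝ), Measurable w ∧ (∀ x, 0 ≤ w x) ∧ 0 < c ∧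
      (∀ ξ : H, ‖ξ‖ ≤ 1 → ∫⁻ x, ENNReal.ofReal (w x * L ξ x ^ 2) ∂m ≤ ENNReal.ofReal c) ∧
      ¬ ∀ᵐ x ∂m, x ∈ E → w x = 0 := by
  have hm := hL.measurable
  obtain ⟨R, hR, hnot⟩ := hL.exists_indicator_notMem_closure hf hE hmE
  obtain ⟨F, u, hFu, huF⟩ := geometric_hahn_banach_closed_point
    (hL.convex_dominatedSet hf.map_zero).closure isClosed_closure hnot
  set w : Lp ℝ 2 m := (InnerProductSpace.toDual ℝ (Lp ℝ 2 m)).symm F with hw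
  have hF : ∀ g, F g = inner ℝ g w := fun g => by
    rw [real_inner_comm, hw, InnerProductSpace.toDual_symm_apply]
  have hD : ∀ g ∈ dominatedSet m L, inner ℝ g w < u := fun g hg => by
    rw [← hF]; exact hFu g (subset_closure hg)
  have hu : 0 < u := by
    have := hD 0 (mem_dominatedSet_of_nonpos (by
      filter_upwards [Lp.coeFn_zero ℝ 2 m] with x hx
      rw [hx]; rfl))
    simpa using this
  have hwint : Integrable w m := (Lp.memLp w).integrable (by norm_num)
  -- All nonpositive `L²` functions are dominated. If `w` had negative integral over `s`, large
  -- multiples of minus the indicator of `s` would violate the bound `u`.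
  have hwpos : 0 ≤ᵐ[m] w := by
    refine ae_nonneg_of_forall_setIntegral_nonneg hwint fun s hs hsm => ?_
    by_contra! hneg
    obtain ⟨n, hn⟩ := exists_nat_gt (u / (-∫ x in s, w x ∂m))
    have h1 := hD (indicatorConstLp 2 hs hsm.ne (-(n : ℝ))) (mem_dominatedSet_of_nonpos (by
      filter_upwards [indicatorConstLp_coeFn (p := 2) (hs := hs) (hμs := hsm.ne)
        (c := (-(n : ℝ)))] with x hx
      rw [hx]
      exact Set.indicator_apply_nonpos fun _ => by simp))
    rw [L2.inner_indicatorConstLp_eq_inner_setIntegral] at h1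
    rw [div_lt_iff₀ (by linarith)] at hn
    simp only [RCLike.inner_apply, conj_trivial] at h1
    linarith
  have hwE : 0 < ∫ x in E, w x ∂m := by
    rw [hF, L2.inner_indicatorConstLp_eq_inner_setIntegral] at huF
    simp only [RCLike.inner_apply, conj_trivial] at huF
    have h1 := hu.trans huF
    exact pos_of_mul_pos_left h1 hR.le
  have hsm := Lp.stronglyMeasurable w
  refine ⟨fun x => max (w x) 0, u, hsm.measurable.max measurable_const, fun x => le_max_right _ _,
    hu, fun ξ hξ => ?_, fun hzero => ?_⟩
  -- Truncation at `N` keeps the square of the process in `L²`, where the separation applies;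
  -- monotone convergence removes it.
  · have hmono : ∀ N : ℕ, ∫⁻ x, ENNReal.ofReal (max (w x) 0 * min (L ξ x ^ 2) N) ∂m
        ≤ ENNReal.ofReal u := by
      intro N
      have hmem : MemLp (fun x => min (L ξ x ^ 2) (N : ℝ)) 2 m := by
        refine MemLp.of_bound (by fun_prop : Measurable _).aestronglyMeasurable N
          (ae_of_all _ fun x => ?_)
        rw [Real.norm_of_nonneg (le_min (sq_nonneg _) (Nat.cast_nonneg _))]
        exact min_le_right _ _
      set G : Lp ℝ 2 m := hmem.toLp with hG
      have h1 := hD G ⟨Unit, inferInstance, fun _ => ξ, by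
        simpa using hξ, by
        filter_upwards [hmem.coeFn_toLp] with x hx
        rw [hx]; simp⟩
      rw [L2.inner_def] at h1
      have h2 : ∀ᵐ x ∂m, inner ℝ (G x) (w x) = max (w x) 0 * min (L ξ x ^ 2) (N : ℝ) := by
        filter_upwards [hmem.coeFn_toLp, hwpos] with x hx hx'
        rw [hx, max_eq_left (show (0 : ℝ) ≤ w x from hx')]
        simp
      rw [← ofReal_integral_eq_lintegral_ofReal, ← integral_congr_ae h2]
      · exact ENNReal.ofReal_le_ofReal h1.le
      · exact (L2.integrable_inner (𝕜 := ℝ) G w).congr h2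
      · exact ae_of_all _ fun x => mul_nonneg (le_max_right _ _)
          (le_min (sq_nonneg _) (Nat.cast_nonneg _))
    refine le_of_tendsto' (lintegral_tendsto_of_tendsto_of_monotone (fun N => ?_)
      (ae_of_all _ fun x => ?_) (ae_of_all _ fun x => ?_)) hmono
    · have := hsm.measurable
      exact (by fun_prop : Measurable _).aemeasurable
    · intro a b hab
      have : (a : ℝ) ≤ b := by exact_mod_cast hab
      exact ENNReal.ofReal_le_ofReal (mul_le_mul_of_nonneg_left (min_le_min_left _ this)
        (le_max_right _ _))
    · refine tendsto_const_nhds.congr' ?_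
      obtain ⟨N, hN⟩ := exists_nat_ge (L ξ x ^ 2)
      filter_upwards [eventually_ge_atTop N] with n hn
      rw [min_eq_left (hN.trans (by exact_mod_cast hn))]
  · refine hwE.ne' ?_
    rw [← integral_indicator hE]
    refine integral_eq_zero_of_ae ?_
    filter_upwards [hzero, hwpos] with x hx hx'
    by_cases hxE : x ∈ E
    · rw [Set.indicator_of_mem hxE, ← max_eq_left hx']
      exact hx hxE
    · rw [Set.indicator_of_notMem hxE]; rfl

end IsLinearProcess

/-! ### The canonical weight as a projection in `L²`. -/

section CanonicalWeight

variable {X : Type*} [MeasurableSpace X]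

/-- Weights `s` with values in `[0, 1]` and `‖s * k‖₂ ≤ 1` for all `k ∈ 𝒦`. -/
structure IsAdmissibleWeight (m : Measure X) (𝒦 : Set (X → ℝ)) (s : X → ℝ) : Prop where
  measurable : Measurable s
  nonneg : ∀ x, 0 ≤ s x
  le_one : ∀ x, s x ≤ 1
  lintegral_le : ∀ k ∈ 𝒦, ∫⁻ x, ENNReal.ofReal ((s x * k x) ^ 2) ∂m ≤ 1

variable {m : Measure X} {𝒦 : Set (X → ℝ)}

theorem IsLinearProcess.exists_admissibleWeight {H : Type*} [NormedAddCommGroup H]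
    [InnerProductSpace ℝ H] {f : H → ℂ} {L : H → X → ℝ} [IsProbabilityMeasure m]
    (hL : IsLinearProcess f m L) (hf : IsNormalizedPosDef f) {B : Set H}
    (hB : ∀ ξ ∈ B, ‖ξ‖ ≤ 1) {E : Set X} (hE : MeasurableSet E) (hmE : m E ≠ 0) :
    ∃ s, IsAdmissibleWeight m (L '' B) s ∧ ¬ ∀ᵐ x ∂m, x ∈ E → s x = 0 := by
  obtain ⟨w, c, hwm, hw0, hc, hint, hne⟩ := hL.exists_weight hf hE hmE
  have hc1 : 0 < max c 1 := by positivity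
  -- Capping `w` at `1` preserves its zero set, and dividing by `max c 1` normalises both the
  -- supremum and the integrals.
  refine ⟨fun x => √(min (w x) 1 / max c 1), ⟨by fun_prop, fun x => Real.sqrt_nonneg _,
    fun x => ?_, ?_⟩, fun hzero => hne ?_⟩
  · refine Real.sqrt_le_one.2 ((div_le_one hc1).2 ?_)
    exact (min_le_right _ _).trans (le_max_right _ _)
  · rintro _ ⟨ξ, hξ, rfl⟩
    have h1 : ∀ x, ENNReal.ofReal ((√(min (w x) 1 / max c 1) * L ξ x) ^ 2)
        ≤ ENNReal.ofReal (max c 1)⁻¹ * ENNReal.ofReal (w x * L ξ x ^ 2) := by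
      intro x
      rw [← ENNReal.ofReal_mul (by positivity), mul_pow, Real.sq_sqrt
        (div_nonneg (le_min (hw0 x) zero_le_one) hc1.le), div_eq_inv_mul, mul_assoc]
      exact ENNReal.ofReal_le_ofReal (by gcongr; exact min_le_left _ _)
    refine (lintegral_mono h1).trans ?_
    rw [lintegral_const_mul' _ _ ENNReal.ofReal_ne_top]
    calc _ ≤ ENNReal.ofReal (max c 1)⁻¹ * ENNReal.ofReal c := by gcongr; exact hint ξ (hB ξ hξ)
      _ = ENNReal.ofReal ((max c 1)⁻¹ * c) := (ENNReal.ofReal_mul (by positivity)).symm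
      _ ≤ 1 := by
        rw [ENNReal.ofReal_le_one, inv_mul_le_iff₀ hc1, mul_one]
        exact le_max_left _ _
  · filter_upwards [hzero] with x hx hxE
    have h1 := hx hxE
    rw [Real.sqrt_eq_zero (div_nonneg (le_min (hw0 x) zero_le_one) hc1.le), div_eq_zero_iff,
      or_iff_left hc1.ne'] at h1
    rcases min_choice (w x) 1 with h | h <;> rw [h] at h1
    · exact h1
    · exact absurd h1 one_ne_zero

/-- The classes in `L²` of the admissible weights. -/
def admissibleClasses (m : Measure X) (𝒦 : Set (X → ℝ)) : Set (Lp ℝ 2 m) :=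
  {g | (∀ᵐ x ∂m, 0 ≤ g x) ∧ (∀ᵐ x ∂m, g x ≤ 1) ∧
    ∀ k ∈ 𝒦, ∫⁻ x, ENNReal.ofReal ((g x * k x) ^ 2) ∂m ≤ 1}

theorem convex_admissibleClasses (h𝒦 : ∀ k ∈ 𝒦, Measurable k) :
    Convex ℝ (admissibleClasses m 𝒦) := by
  rintro g ⟨hg0, hg1, hg⟩ g' ⟨hg0', hg1', hg'⟩ a b ha hb hab
  have hadd : ∀ᵐ x ∂m, (a • g + b • g') x = a * g x + b * g' x := by
    filter_upwards [Lp.coeFn_add (a • g) (b • g'), Lp.coeFn_smul a g, Lp.coeFn_smul b g']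
      with x e1 e2 e3
    rw [e1, Pi.add_apply, e2, e3]; rfl
  refine ⟨?_, ?_, fun k hk => ?_⟩
  · filter_upwards [hadd, hg0, hg0'] with x h h1 h2
    rw [h]; positivity
  · filter_upwards [hadd, hg1, hg1'] with x h h1 h2
    rw [h]; nlinarith
  · have hkm := h𝒦 k hk
    have hle : ∀ᵐ x ∂m, ENNReal.ofReal (((a • g + b • g') x * k x) ^ 2)
        ≤ ENNReal.ofReal a * ENNReal.ofReal ((g x * k x) ^ 2)
          + ENNReal.ofReal b * ENNReal.ofReal ((g' x * k x) ^ 2) := by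
      filter_upwards [hadd] with x h
      rw [h, ← ENNReal.ofReal_mul ha, ← ENNReal.ofReal_mul hb,
        ← ENNReal.ofReal_add (by positivity) (by positivity)]
      refine ENNReal.ofReal_le_ofReal ?_
      obtain rfl : b = 1 - a := by linarith
      nlinarith [mul_nonneg (mul_nonneg ha hb) (sq_nonneg (g x * k x - g' x * k x))]
    refine (lintegral_mono_ae hle).trans ?_
    have hgm := (Lp.stronglyMeasurable g).measurable
    have hgm' := (Lp.stronglyMeasurable g').measurable
    rw [lintegral_add_left (by fun_prop), lintegral_const_mul' _ _ ENNReal.ofReal_ne_top,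
      lintegral_const_mul' _ _ ENNReal.ofReal_ne_top]
    calc _ ≤ ENNReal.ofReal a * 1 + ENNReal.ofReal b * 1 := by
          gcongr
          · exact hg k hk
          · exact hg' k hk
      _ = 1 := by rw [mul_one, mul_one, ← ENNReal.ofReal_add ha hb, hab, ENNReal.ofReal_one]

theorem isClosed_admissibleClasses (h𝒦 : ∀ k ∈ 𝒦, Measurable k) :
    IsClosed (admissibleClasses m 𝒦) := by
  refine IsSeqClosed.isClosed fun g g₀ hg hlim => ?_
  obtain ⟨n, -, hn⟩ := (tendstoInMeasure_of_tendsto_Lp hlim).exists_seq_tendsto_ae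
  refine ⟨?_, ?_, fun k hk => ?_⟩
  · filter_upwards [hn, ae_all_iff.2 fun i => (hg i).1] with x hx h
    exact ge_of_tendsto' hx fun i => h _
  · filter_upwards [hn, ae_all_iff.2 fun i => (hg i).2.1] with x hx h
    exact le_of_tendsto' hx fun i => h _
  · have hkm := h𝒦 k hk
    have hgm := fun i => (Lp.stronglyMeasurable (g i)).measurable
    have hle : ∀ᵐ x ∂m, ENNReal.ofReal ((g₀ x * k x) ^ 2)
        ≤ liminf (fun i => ENNReal.ofReal ((g (n i) x * k x) ^ 2)) atTop := by
      filter_upwards [hn] with x hx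
      refine (Tendsto.liminf_eq ?_).ge
      exact (ENNReal.continuous_ofReal.tendsto _).comp ((hx.mul_const _).pow 2)
    refine (lintegral_mono_ae hle).trans ((lintegral_liminf_le fun i => by fun_prop).trans ?_)
    exact liminf_le_of_le (by isBoundedDefault)
      fun b hb => hb.exists.elim fun i hi => hi.trans ((hg _).2.2 k hk)

namespace IsAdmissibleWeight

variable {s s' : X → ℝ}

/-- The integral constraint is linear in `s²`. Mixing squares moves `s` by order `√ε` where it
vanishes, which a linear mixture would not do. -/
theorem sqrt_combination (hs : IsAdmissibleWeight m 𝒦 s) (hs' : IsAdmissibleWeight m 𝒦 s')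
    (h𝒦 : ∀ k ∈ 𝒦, Measurable k) {ε : ℝ} (h0 : 0 ≤ ε) (h1 : ε ≤ 1) :
    IsAdmissibleWeight m 𝒦 fun x => √((1 - ε) * s x ^ 2 + ε * s' x ^ 2) := by
  have hsm := hs.measurable
  have hsm' := hs'.measurable
  have h1' : 0 ≤ 1 - ε := by linarith
  refine ⟨by fun_prop, fun x => Real.sqrt_nonneg _, fun x => ?_, fun k hk => ?_⟩
  · refine Real.sqrt_le_one.2 ?_
    have e1 := pow_le_one₀ (n := 2) (hs.nonneg x) (hs.le_one x)
    have e2 := pow_le_one₀ (n := 2) (hs'.nonneg x) (hs'.le_one x)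
    nlinarith
  · have hkm := h𝒦 k hk
    have heq : ∀ x, ENNReal.ofReal ((√((1 - ε) * s x ^ 2 + ε * s' x ^ 2) * k x) ^ 2)
        = ENNReal.ofReal (1 - ε) * ENNReal.ofReal ((s x * k x) ^ 2)
          + ENNReal.ofReal ε * ENNReal.ofReal ((s' x * k x) ^ 2) := by
      intro x
      rw [← ENNReal.ofReal_mul h1', ← ENNReal.ofReal_mul h0,
        ← ENNReal.ofReal_add (by positivity) (by positivity), mul_pow,
        Real.sq_sqrt (by positivity)]
      congr 1; ring
    simp_rw [heq]
    rw [lintegral_add_left (by fun_prop), lintegral_const_mul' _ _ ENNReal.ofReal_ne_top,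
      lintegral_const_mul' _ _ ENNReal.ofReal_ne_top]
    calc _ ≤ ENNReal.ofReal (1 - ε) * 1 + ENNReal.ofReal ε * 1 := by
          gcongr
          · exact hs.lintegral_le k hk
          · exact hs'.lintegral_le k hk
      _ = 1 := by
        rw [mul_one, mul_one, ← ENNReal.ofReal_add h1' h0, sub_add_cancel, ENNReal.ofReal_one]

variable [IsProbabilityMeasure m]

theorem memLp (hs : IsAdmissibleWeight m 𝒦 s) (p : ENNReal) : MemLp s p m :=
  MemLp.of_bound hs.measurable.aestronglyMeasurable 1
    (ae_of_all _ fun x => by rw [Real.norm_of_nonneg (hs.nonneg x)]; exact hs.le_one x)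

theorem toLp_mem (hs : IsAdmissibleWeight m 𝒦 s) : (hs.memLp 2).toLp ∈ admissibleClasses m 𝒦 := by
  have h := (hs.memLp 2).coeFn_toLp
  refine ⟨?_, ?_, fun k hk => ?_⟩
  · filter_upwards [h] with x hx
    rw [hx]; exact hs.nonneg x
  · filter_upwards [h] with x hx
    rw [hx]; exact hs.le_one x
  · refine (lintegral_congr_ae ?_).trans_le (hs.lintegral_le k hk)
    filter_upwards [h] with x hx
    rw [hx]

theorem integrable_one_sub_sq (hs : IsAdmissibleWeight m 𝒦 s) :
    Integrable (fun x => (1 - s x) ^ 2) m :=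
  ((memLp_const 1).sub (hs.memLp 2)).integrable_sq

/-- A weight that minimises the distance to `1` is positive, because near `0` the square root
outgrows every linear function. -/
theorem pos_of_isMinimal (hs : IsAdmissibleWeight m 𝒦 s) (h𝒦 : ∀ k ∈ 𝒦, Measurable k)
    (hmin : ∀ s', IsAdmissibleWeight m 𝒦 s' → ∫ x, (1 - s x) ^ 2 ∂m ≤ ∫ x, (1 - s' x) ^ 2 ∂m)
    (h : ∀ E, MeasurableSet E → m E ≠ 0 →
      ∃ s', IsAdmissibleWeight m 𝒦 s' ∧ ¬ ∀ᵐ x ∂m, x ∈ E → s' x = 0) :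
    ∀ᵐ x ∂m, 0 < s x := by
  have hE : MeasurableSet {x | s x = 0} := measurableSet_eq_fun hs.measurable measurable_const
  set E := {x | s x = 0} with hEdef
  by_contra hnot
  have hmE : m E ≠ 0 := by
    intro h0
    refine hnot ?_
    filter_upwards [measure_eq_zero_iff_ae_notMem.1 h0] with x hx
    exact lt_of_le_of_ne (hs.nonneg x) fun h => hx h.symm
  obtain ⟨s₀, hs₀, hne⟩ := h E hE hmE
  have hint : Integrable (E.indicator s₀) m := ((hs₀.memLp 1).integrable le_rfl).indicator hE
  -- Mix with `ε = δ²`. On `E` the new weight is at least `δ * s₀`, a gain of first order in `δ`,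
  -- while the total cost is at most `3 * δ²`; letting `δ → 0` gives `s₀ = 0` a.e. on `E`.
  have hbound : ∀ δ : ℝ, 0 < δ → δ ≤ 1 → ∫ x, E.indicator s₀ x ∂m ≤ 3 / 2 * δ := by
    intro δ hδ hδ1
    have hδ2 : δ ^ 2 ≤ 1 := pow_le_one₀ hδ.le hδ1
    have hr := hs.sqrt_combination hs₀ h𝒦 (sq_nonneg δ) hδ2
    have hle : ∫ x, (1 - √((1 - δ ^ 2) * s x ^ 2 + δ ^ 2 * s₀ x ^ 2)) ^ 2 ∂m
        ≤ ∫ x, ((1 - s x) ^ 2 + 3 * δ ^ 2 - 2 * δ * E.indicator s₀ x) ∂m := by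
      refine integral_mono hr.integrable_one_sub_sq
        ((hs.integrable_one_sub_sq.add (integrable_const _)).sub (hint.const_mul _)) fun x => ?_
      have hsx := hs.nonneg x
      have hsx1 := hs.le_one x
      have h0x := hs₀.nonneg x
      have h0x1 := hs₀.le_one x
      have h1δ : 0 ≤ 1 - δ ^ 2 := by linarith
      set r := √((1 - δ ^ 2) * s x ^ 2 + δ ^ 2 * s₀ x ^ 2) with hrdef
      have hr2 : r ^ 2 = (1 - δ ^ 2) * s x ^ 2 + δ ^ 2 * s₀ x ^ 2 := Real.sq_sqrt (by positivity)
      have hr2le : r ^ 2 ≤ s x ^ 2 + δ ^ 2 := by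
        have : s₀ x ^ 2 ≤ 1 := pow_le_one₀ h0x h0x1
        nlinarith [mul_nonneg (sq_nonneg δ) (sq_nonneg (s x)), sq_nonneg δ]
      have hrlow : (1 - δ ^ 2) * s x + δ * E.indicator s₀ x ≤ r := by
        refine Real.le_sqrt_of_sq_le ?_
        by_cases hx : x ∈ E
        · rw [Set.indicator_of_mem hx, show s x = 0 from hx]
          nlinarith
        · rw [Set.indicator_of_notMem hx]
          have : (1 - δ ^ 2) ^ 2 ≤ 1 - δ ^ 2 := by nlinarith [sq_nonneg δ]
          nlinarith [mul_nonneg (sq_nonneg δ) (sq_nonneg (s₀ x)),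
            mul_le_mul_of_nonneg_right this (sq_nonneg (s x))]
      have : δ ^ 2 * s x ≤ δ ^ 2 := mul_le_of_le_one_right (sq_nonneg δ) hsx1
      change (1 - r) ^ 2 ≤ (1 - s x) ^ 2 + 3 * δ ^ 2 - 2 * δ * E.indicator s₀ x
      nlinarith
    have hmin' := (hmin _ hr).trans hle
    have heq : ∫ x, ((1 - s x) ^ 2 + 3 * δ ^ 2 - 2 * δ * E.indicator s₀ x) ∂m
        = ∫ x, (1 - s x) ^ 2 ∂m + 3 * δ ^ 2 - 2 * δ * ∫ x, E.indicator s₀ x ∂m := by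
      have hadd : Integrable (fun x => (1 - s x) ^ 2 + 3 * δ ^ 2) m :=
        hs.integrable_one_sub_sq.add (integrable_const _)
      rw [integral_sub hadd (hint.const_mul _),
        integral_add hs.integrable_one_sub_sq (integrable_const _)]
      simp [integral_const_mul]
    rw [heq] at hmin'
    have h2 : δ * (2 * ∫ x, E.indicator s₀ x ∂m) ≤ δ * (3 * δ) := by nlinarith
    have := le_of_mul_le_mul_left h2 hδ
    linarith
  have hnonneg : 0 ≤ E.indicator s₀ := fun x => Set.indicator_nonneg (fun x _ => hs₀.nonneg x) x
  have hzero : ∫ x, E.indicator s₀ x ∂m = 0 := by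
    refine le_antisymm ?_ (integral_nonneg hnonneg)
    by_contra! hpos
    set I := ∫ x, E.indicator s₀ x ∂m with hI
    have := hbound (min 1 (I / 3)) (by positivity) (min_le_left _ _)
    have := min_le_right 1 (I / 3)
    linarith
  refine hne ?_
  filter_upwards [(integral_eq_zero_iff_of_nonneg hnonneg hint).1 hzero] with x hx hxE
  rwa [Set.indicator_of_mem hxE] at hx

end IsAdmissibleWeight

/-- Project `1` onto the closed convex set of admissible classes. Uniqueness of the projection will
give invariance under every symmetry of the constraints. -/
theorem exists_canonical_weight [IsProbabilityMeasure m] (h𝒦 : ∀ k ∈ 𝒦, Measurable k)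
    (h : ∀ E, MeasurableSet E → m E ≠ 0 →
      ∃ s, IsAdmissibleWeight m 𝒦 s ∧ ¬ ∀ᵐ x ∂m, x ∈ E → s x = 0) :
    ∃ s, IsAdmissibleWeight m 𝒦 s ∧ (∀ᵐ x ∂m, 0 < s x) ∧
      ∀ s', IsAdmissibleWeight m 𝒦 s' → ∫ x, (1 - s' x) ^ 2 ∂m = ∫ x, (1 - s x) ^ 2 ∂m →
        s' =ᵐ[m] s := by
  have hone : MemLp (fun _ : X => (1 : ℝ)) 2 m := memLp_const 1
  have hK := convex_admissibleClasses (m := m) h𝒦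
  have hne : (admissibleClasses m 𝒦).Nonempty := by
    have h0 : IsAdmissibleWeight m 𝒦 fun _ => 0 :=
      ⟨measurable_const, fun _ => le_rfl, fun _ => zero_le_one, by simp⟩
    exact ⟨_, h0.toLp_mem⟩
  obtain ⟨v, hv, hvmin⟩ := exists_norm_eq_iInf_of_complete_convex hne
    (isClosed_admissibleClasses h𝒦).isComplete hK hone.toLp
  have hvinner := (norm_eq_iInf_iff_real_inner_le_zero hK hv).1 hvmin
  have hvm := (Lp.stronglyMeasurable v).measurable
  have hsv : (fun x => max 0 (min 1 (v x))) =ᵐ[m] v := by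
    filter_upwards [hv.1, hv.2.1] with x h0 h1
    rw [min_eq_right h1, max_eq_right h0]
  have hs : IsAdmissibleWeight m 𝒦 fun x => max 0 (min 1 (v x)) := by
    refine ⟨by fun_prop, fun x => le_max_left _ _, fun x => max_le zero_le_one (min_le_left _ _),
      fun k hk => (lintegral_congr_ae ?_).trans_le (hv.2.2 k hk)⟩
    filter_upwards [hsv] with x hx
    rw [hx]
  have hnorm : ∀ s' (hs' : IsAdmissibleWeight m 𝒦 s'),
      ‖hone.toLp - (hs'.memLp 2).toLp‖ ^ 2 = ∫ x, (1 - s' x) ^ 2 ∂m := by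
    intro s' hs'
    rw [← MemLp.toLp_sub, ← real_inner_self_eq_norm_sq, L2.inner_def]
    refine integral_congr_ae ?_
    filter_upwards [(hone.sub (hs'.memLp 2)).coeFn_toLp] with x hx
    rw [hx]
    simp [sq]
  have hvs : (hs.memLp 2).toLp = v := by
    refine Lp.ext ?_
    exact (hs.memLp 2).coeFn_toLp.trans hsv
  have hle : ∀ w ∈ admissibleClasses m 𝒦, ‖hone.toLp - v‖ ≤ ‖hone.toLp - w‖ := fun w hw => by
    rw [hvmin]
    exact ciInf_le ⟨0, by rintro _ ⟨y, rfl⟩; exact norm_nonneg _⟩ (⟨w, hw⟩ : admissibleClasses m 𝒦)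
  refine ⟨_, hs, hs.pos_of_isMinimal h𝒦 (fun s' hs' => ?_) h, fun s' hs' heq => ?_⟩
  · rw [← hnorm _ hs, ← hnorm _ hs', hvs]
    exact pow_le_pow_left₀ (norm_nonneg _) (hle _ hs'.toLp_mem) 2
  · rw [← hnorm _ hs, ← hnorm _ hs', hvs] at heq
    set w := (hs'.memLp 2).toLp with hw
    have heq' : ‖hone.toLp - w‖ = ‖hone.toLp - v‖ :=
      (pow_left_inj₀ (norm_nonneg _) (norm_nonneg _) two_ne_zero).1 heq
    have hwinner := (norm_eq_iInf_iff_real_inner_le_zero hK hs'.toLp_mem).1 (heq'.trans hvmin)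
    have e1 := hvinner w hs'.toLp_mem
    have e2 := hwinner v hv
    -- Sum of the variational inequalities at the two minimisers.
    have e3 : ‖w - v‖ ^ 2 ≤ 0 := by
      rw [← real_inner_self_eq_norm_sq]
      have : (inner ℝ (w - v) (w - v) : ℝ) = inner ℝ (hone.toLp - v) (w - v)
          + inner ℝ (hone.toLp - w) (v - w) := by
        rw [← neg_sub w v, inner_neg_right, ← sub_eq_add_neg, ← inner_sub_left]
        congr 1; abel
      rw [this]
      linarith
    have hwv : w = v := by
      rw [← sub_eq_zero, ← norm_eq_zero]
      exact pow_eq_zero_iff two_ne_zero |>.1 (le_antisymm e3 (sq_nonneg _))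
    filter_upwards [(hs'.memLp 2).coeFn_toLp, hsv] with x hx hx'
    rw [hx', ← hwv, hw, hx]

end CanonicalWeight

namespace IsLinearProcess

variable {H X : Type*} [NormedAddCommGroup H] [NormedSpace ℝ H] [MeasurableSpace X] {f : H → ℂ}
  {m : Measure X} {L : H → X → ℝ} [IsProbabilityMeasure m]

theorem ae_eq_of_tendsto (hL : IsLinearProcess f m L) (hf : IsNormalizedPosDef f) {ζ : ℕ → H}
    {ζ₀ : H} (hζ : Tendsto ζ atTop (𝓝 ζ₀)) {Y : X → ℝ} (hY : Measurable Y)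
    (hlim : ∀ᵐ x ∂m, Tendsto (fun n => L (ζ n) x) atTop (𝓝 (Y x))) : Y =ᵐ[m] L ζ₀ := by
  have hm := hL.measurable
  have h0 := ae_eq_zero_of_integral_exp_eq_one (m := m) (Y := fun x => Y x - L ζ₀ x)
    (hY.sub (hm _)) fun s => by
      have hint : ∀ n, ∫ x, Complex.exp (((s * (L (ζ n) x - L ζ₀ x) : ℝ) : ℂ) * Complex.I) ∂m
          = f (s • (ζ n - ζ₀)) := fun n => by
        have := hL.law (ι := Fin 2) ![ζ n, ζ₀] ![s, -s]
        simp only [Fin.sum_univ_two, Matrix.cons_val_zero, Matrix.cons_val_one, neg_smul,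
          neg_mul, ← sub_eq_add_neg, ← smul_sub, ← mul_sub] at this
        exact this
      have h1 : Tendsto (fun n => f (s • (ζ n - ζ₀))) atTop (𝓝 1) := by
        have := (hf.continuous.tendsto (s • (ζ₀ - ζ₀))).comp
          ((hζ.sub_const ζ₀).const_smul s)
        simpa [hf.map_zero, Function.comp_def] using this
      simp_rw [← hint] at h1
      refine tendsto_nhds_unique ?_ h1
      refine tendsto_integral_of_dominated_convergence (fun _ => 1) ?_ (integrable_const _) ?_ ?_
      · exact fun n => (by fun_prop : Measurable _).aestronglyMeasurable
      · exact fun n => ae_of_all _ fun x => (Complex.norm_exp_ofReal_mul_I _).le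
      · filter_upwards [hlim] with x hx
        have hc : Continuous fun y : ℝ => Complex.exp ((y : ℂ) * Complex.I) := by fun_prop
        exact (hc.tendsto _).comp ((hx.sub_const _).const_mul s)
  filter_upwards [h0] with x hx
  exact sub_eq_zero.1 hx

theorem tendstoInMeasure (hL : IsLinearProcess f m L) (hf : IsNormalizedPosDef f) {U : Type*}
    {l : Filter U} {ζ : U → H} {ζ₀ : H} (hζ : Tendsto ζ l (𝓝 ζ₀)) :
    TendstoInMeasure m (fun i => L (ζ i)) l (L ζ₀) := by
  rw [tendstoInMeasure_iff_measureReal_norm]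
  intro ε hε
  rw [Metric.tendsto_nhds]
  intro η hη
  obtain ⟨δ, hδ, h⟩ := hL.exists_tail_bound hf (ε := min (ε / 2) (η / 2)) (by positivity)
  filter_upwards [Metric.tendsto_nhds.1 hζ δ hδ] with i hi
  rw [dist_eq_norm] at hi
  rw [Real.dist_eq, sub_zero, abs_of_nonneg measureReal_nonneg]
  have h1 : m.real {x | ε ≤ ‖L (ζ i) x - L ζ₀ x‖}
      ≤ m.real {x | min (ε / 2) (η / 2) < |L (ζ i - ζ₀) x|} := by
    refine ENNReal.toReal_mono (measure_ne_top _ _) (measure_mono_ae ?_)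
    filter_upwards [hL.map_sub hf.map_zero (ζ i) ζ₀] with x hx hle
    change min (ε / 2) (η / 2) < |L (ζ i - ζ₀) x|
    have hle' : ε ≤ |L (ζ i) x - L ζ₀ x| := hle
    rw [hx]
    exact (min_le_left _ _).trans_lt ((half_lt_self hε).trans_le hle')
  have := h _ hi
  have := min_le_right (ε / 2) (η / 2)
  linarith

end IsLinearProcess

/-! ### The action of symmetries on sequences. -/

section CoordMap

variable {H : Type*} [NormedAddCommGroup H] [NormedSpace ℝ H]

/-- The map of the sequence space induced by `u : H → H`, on coordinates `L (d k) ↦ L (u (d k))`. -/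
def coordMap (L : H → (ℕ → ℝ) → ℝ) (d : ℕ → H) (u : H → H) (x : ℕ → ℝ) : ℕ → ℝ :=
  fun k => L (u (d k)) x

variable {f : H → ℂ} {d : ℕ → H} {m : Measure (ℕ → ℝ)} [IsProbabilityMeasure m]
  {L : H → (ℕ → ℝ) → ℝ}

/-- Finite-dimensional marginals agree because their characteristic functions are `f (u (∑ c i • d
i))` and `f (∑ c i • d i)`. -/
theorem measurePreserving_coordMap (hL : ∀ ξ, IsCoordLimit d m ξ (L ξ))
    (h : HasSequenceLaw f d m) (hf : IsNormalizedPosDef f) (u : H →L[ℝ] H)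
    (hu : ∀ ξ, f (u ξ) = f ξ) : MeasurePreserving (coordMap L d u) m m := by
  have hP := IsCoordLimit.isLinearProcess h hf.continuous hL
  have hm := hP.measurable
  have hmeas : Measurable (coordMap L d u) := measurable_pi_lambda _ fun k => hm _
  refine ⟨hmeas, ?_⟩
  have key := (ProbabilityTheory.map_eq_iff_forall_finset_map_restrict_eq (P := m)
    (X := fun k x => coordMap L d u x k) (Y := fun k x => x k)
    hmeas.aemeasurable measurable_id.aemeasurable).2 ?_
  · exact key.trans Measure.map_id
  · intro J
    have hm1 : Measurable fun x => J.restrict (fun k => coordMap L d u x k) :=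
      (Finset.measurable_restrict J).comp hmeas
    have hm2 : Measurable fun x : ℕ → ℝ => J.restrict (fun k => x k) :=
      Finset.measurable_restrict J
    have i1 := Measure.isProbabilityMeasure_map (μ := m) hm1.aemeasurable
    have i2 := Measure.isProbabilityMeasure_map (μ := m) hm2.aemeasurable
    refine Measure.ext_of_charFunDual (funext fun ℓ => ?_)
    rw [charFunDual_apply, charFunDual_apply, integral_map hm1.aemeasurable (by fun_prop),
      integral_map hm2.aemeasurable (by fun_prop)]
    classical
    obtain ⟨c, hc⟩ : ∃ c : J → ℝ, ∀ v : J → ℝ, ℓ v = ∑ i, c i * v i := by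
      refine ⟨fun i => ℓ (Pi.single i 1), fun v => ?_⟩
      have hv : v = ∑ i, v i • Pi.single i (1 : ℝ) := by
        ext j
        simp [Finset.sum_apply, Pi.single_apply]
      conv_lhs => rw [hv]
      rw [_root_.map_sum]
      refine Finset.sum_congr rfl fun i _ => ?_
      rw [_root_.map_smul, smul_eq_mul, mul_comm]
    simp_rw [hc]
    have e1 := hP.law (fun i : J => u (d i)) c
    have e2 := h.law_family (fun i : J => (i : ℕ)) c
    simp_rw [← _root_.map_smul, ← _root_.map_sum, hu] at e1
    exact e1.trans e2.symm

theorem comp_coordMap (hL : ∀ ξ, IsCoordLimit d m ξ (L ξ))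
    (h : HasSequenceLaw f d m) (hf : IsNormalizedPosDef f) (u : H →L[ℝ] H)
    (hu : ∀ ξ, f (u ξ) = f ξ) (ξ : H) : (fun x => L ξ (coordMap L d u x)) =ᵐ[m] L (u ξ) := by
  have hP := IsCoordLimit.isLinearProcess h hf.continuous hL
  have hτ := measurePreserving_coordMap hL h hf u hu
  obtain ⟨hLm, k, hk, hlim⟩ := hL ξ
  refine hP.ae_eq_of_tendsto hf ((u.continuous.tendsto ξ).comp hk) (hLm.comp hτ.measurable) ?_
  exact hτ.quasiMeasurePreserving.ae hlim

/-- The order of composition is reversed, so the homomorphism `β` has to be built from inverses. -/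
theorem coordMap_comp (hL : ∀ ξ, IsCoordLimit d m ξ (L ξ))
    (h : HasSequenceLaw f d m) (hf : IsNormalizedPosDef f) (u : H → H) (v : H →L[ℝ] H)
    (hv : ∀ ξ, f (v ξ) = f ξ) :
    (fun x => coordMap L d u (coordMap L d v x)) =ᵐ[m] coordMap L d (fun ξ => v (u ξ)) := by
  filter_upwards [ae_all_iff.2 fun k => comp_coordMap hL h hf v hv (u (d k))] with x hx
  exact funext hx

theorem coordMap_id (hL : ∀ ξ, IsCoordLimit d m ξ (L ξ)) (h : HasSequenceLaw f d m)
    (hf : IsNormalizedPosDef f) : coordMap L d (fun ξ => ξ) =ᵐ[m] id := by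
  filter_upwards [ae_all_iff.2 fun k => (hL (d k)).ae_eq h hf (isCoordLimit_coord k)] with x hx
  exact funext hx

end CoordMap

/-! ### From a.e. invertible maps to Borel automorphisms. -/

section Realization

variable {X : Type*} [MeasurableSpace X] [StandardBorelSpace X] {m : Measure X}

/-- A measure preserving map which is invertible almost everywhere agrees almost everywhere with a
Borel automorphism, provided there is an uncountable null set to absorb the exceptional sets. -/
theorem exists_mpEquiv_of_ae_inverse {τ σ : X → X} (hτ : MeasurePreserving τ m m)
    (hσ : MeasurePreserving σ m m) (hστ : ∀ᵐ x ∂m, σ (τ x) = x) (hτσ : ∀ᵐ x ∂m, τ (σ x) = x)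
    {N : Set X} (hN : MeasurableSet N) (hN0 : m N = 0) (hNc : ¬ N.Countable) :
    ∃ t : MPEquiv m, t.1 =ᵐ[m] τ ∧ t.1.symm =ᵐ[m] σ := by
  classical
  have hτm := hτ.measurable
  have hσm := hσ.measurable
  set A : Set X := {x | σ (τ x) = x} ∩ (Nᶜ ∩ τ ⁻¹' Nᶜ) with hA
  set B : Set X := {x | τ (σ x) = x} ∩ (Nᶜ ∩ σ ⁻¹' Nᶜ) with hB
  have hAm : MeasurableSet A := (measurableSet_eq_fun (hσm.comp hτm) measurable_id).inter
    (hN.compl.inter (hτm hN.compl))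
  have hBm : MeasurableSet B := (measurableSet_eq_fun (hτm.comp hσm) measurable_id).inter
    (hN.compl.inter (hσm hN.compl))
  have hAB : ∀ x ∈ A, τ x ∈ B := by
    rintro x ⟨h1, h2, h3⟩
    have h1' : σ (τ x) = x := h1
    refine ⟨congrArg τ h1', h3, ?_⟩
    change σ (τ x) ∈ Nᶜ
    rwa [h1']
  have hBA : ∀ x ∈ B, σ x ∈ A := by
    rintro x ⟨h1, h2, h3⟩
    have h1' : τ (σ x) = x := h1
    refine ⟨congrArg σ h1', h3, ?_⟩
    change τ (σ x) ∈ Nᶜ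
    rwa [h1']
  let e₁ : A ≃ᵐ B :=
    { toFun := fun x => ⟨τ x, hAB x x.2⟩
      invFun := fun x => ⟨σ x, hBA x x.2⟩
      left_inv := fun x => Subtype.ext x.2.1
      right_inv := fun x => Subtype.ext x.2.1
      measurable_toFun := (hτm.comp measurable_subtype_coe).subtype_mk
      measurable_invFun := (hσm.comp measurable_subtype_coe).subtype_mk }
  have hNA : N ⊆ Aᶜ := by
    intro x hx hxA
    exact hxA.2.1 hx
  have hcA : ¬ Countable (Aᶜ : Set X) := fun hc =>
    hNc ((Set.countable_coe_iff.1 hc).mono hNA)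
  have hNB : N ⊆ Bᶜ := by
    intro x hx hxB
    exact hxB.2.1 hx
  have hcB : ¬ Countable (Bᶜ : Set X) := fun hc =>
    hNc ((Set.countable_coe_iff.1 hc).mono hNB)
  have := hAm.compl.standardBorel
  have := hBm.compl.standardBorel
  -- Both complements contain the uncountable set `N`, hence are Borel isomorphic. Any isomorphism
  -- will do, since `A` has full measure.
  let e₂ : (Aᶜ : Set X) ≃ᵐ (Bᶜ : Set X) := PolishSpace.measurableEquivOfNotCountable hcA hcB
  let t : X ≃ᵐ X := (MeasurableEquiv.sumCompl hAm).symm.trans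
    ((MeasurableEquiv.sumCongr e₁ e₂).trans (MeasurableEquiv.sumCompl hBm))
  have htA : ∀ x ∈ A, t x = τ x := by
    intro x hx
    have h1 : (MeasurableEquiv.sumCompl hAm).symm x = Sum.inl ⟨x, hx⟩ := by
      rw [MeasurableEquiv.symm_apply_eq]
      rfl
    change MeasurableEquiv.sumCompl hBm
      (MeasurableEquiv.sumCongr e₁ e₂ ((MeasurableEquiv.sumCompl hAm).symm x)) = τ x
    rw [h1]
    rfl
  have hN1 : ∀ᵐ x ∂m, x ∉ N := measure_eq_zero_iff_ae_notMem.1 hN0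
  have hN2 : ∀ᵐ x ∂m, τ x ∉ N := hτ.quasiMeasurePreserving.ae hN1
  have ht : t =ᵐ[m] τ := by
    filter_upwards [hστ, hN1, hN2] with x h1 h2 h3
    exact htA x ⟨h1, h2, h3⟩
  have htp : MeasurePreserving t m m := ⟨t.measurable, (Measure.map_congr ht).trans hτ.map_eq⟩
  refine ⟨⟨t, htp⟩, ht, ?_⟩
  filter_upwards [hσ.quasiMeasurePreserving.ae ht, hτσ] with x h1 h2
  rw [MeasurableEquiv.symm_apply_eq, h1, h2]

end Realization

/-! ### Convergence in probability implies weak convergence. -/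

section Continuity

variable {X U : Type*} [MeasurableSpace X] {m : Measure X} [IsProbabilityMeasure m]

/-- Where the two sublevel sets differ, either `|Y u - Y₀| ≥ δ` or `|Y₀ - a| ≤ δ`. The latter event
is small because `a` is not an atom of `Y₀`. -/
theorem tendsto_measure_symmDiff_Iic {l : Filter U} {Y : U → X → ℝ} {Y₀ : X → ℝ}
    (hY₀ : Measurable Y₀) (h : TendstoInMeasure m Y l Y₀) {a : ℝ} (ha : m {x | Y₀ x = a} = 0) :
    Tendsto (fun u => m (symmDiff {x | Y u x ≤ a} {x | Y₀ x ≤ a})) l (𝓝 0) := by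
  rw [ENNReal.tendsto_nhds_zero]
  intro ε hε
  have hsmall : ∃ δ > 0, m {x | |Y₀ x - a| ≤ δ} ≤ ε / 2 := by
    have hanti : Antitone fun n : ℕ => {x | |Y₀ x - a| ≤ 1 / ((n : ℝ) + 1)} := by
      intro i j hij x hx
      have hx' : |Y₀ x - a| ≤ 1 / ((j : ℝ) + 1) := hx
      have hij' : (i : ℝ) ≤ j := by exact_mod_cast hij
      exact hx'.trans (one_div_le_one_div_of_le (by positivity) (by linarith))
    have hmeas : ∀ n : ℕ, MeasurableSet {x | |Y₀ x - a| ≤ 1 / ((n : ℝ) + 1)} := fun n =>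
      measurableSet_le (by fun_prop) measurable_const
    have hlim := tendsto_measure_iInter_atTop (μ := m)
      (fun n => (hmeas n).nullMeasurableSet) hanti ⟨0, measure_ne_top _ _⟩
    have hsub : m (⋂ n : ℕ, {x | |Y₀ x - a| ≤ 1 / ((n : ℝ) + 1)}) = 0 := by
      refine measure_mono_null (fun x hx => ?_) ha
      have hx' := fun n : ℕ => Set.mem_iInter.1 hx n
      have : |Y₀ x - a| ≤ 0 :=
        ge_of_tendsto' tendsto_one_div_add_atTop_nhds_zero_nat hx'
      exact sub_eq_zero.1 (abs_eq_zero.1 (le_antisymm this (abs_nonneg _)))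
    rw [hsub] at hlim
    obtain ⟨n, hn⟩ := ((ENNReal.tendsto_nhds_zero.1 hlim) (ε / 2)
      (ENNReal.half_pos hε.ne')).exists
    exact ⟨_, by positivity, hn⟩
  obtain ⟨δ, hδ, hδε⟩ := hsmall
  have h1 := (tendstoInMeasure_iff_norm.1 h) δ hδ
  filter_upwards [(ENNReal.tendsto_nhds_zero.1 h1) (ε / 2) (ENNReal.half_pos hε.ne')] with u hu
  have hcov : symmDiff {x | Y u x ≤ a} {x | Y₀ x ≤ a}
      ⊆ {x | δ ≤ ‖Y u x - Y₀ x‖} ∪ {x | |Y₀ x - a| ≤ δ} := by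
    intro x hx
    by_contra hnot
    rw [Set.mem_union, not_or] at hnot
    have h1 : ‖Y u x - Y₀ x‖ < δ := not_le.1 hnot.1
    have h2 : δ < |Y₀ x - a| := not_le.1 hnot.2
    rw [Real.norm_eq_abs, abs_lt] at h1
    rcases lt_abs.1 h2 with h2 | h2 <;> rcases hx with ⟨h3, h4⟩ | ⟨h3, h4⟩ <;>
      simp only [Set.mem_ofPred_eq, not_le] at h3 h4 <;> linarith
  calc _ ≤ m {x | δ ≤ ‖Y u x - Y₀ x‖} + m {x | |Y₀ x - a| ≤ δ} :=
        (measure_mono hcov).trans (measure_union_le _ _)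
    _ ≤ ε / 2 + ε / 2 := add_le_add hu hδε
    _ = ε := ENNReal.add_halves ε

/-- The sets whose preimages under `τ u` converge to the preimage under `τ₀` form a σ-algebra. -/
@[reducible] def convergencePreimageSpace (m : Measure X) [IsProbabilityMeasure m] (l : Filter U)
    {τ : U → X → X} {τ₀ : X → X} (hτ : ∀ u, MeasurePreserving (τ u) m m)
    (hτ₀ : MeasurePreserving τ₀ m m) : MeasurableSpace X where
  MeasurableSet' A := MeasurableSet A ∧
    Tendsto (fun u => m (symmDiff (τ u ⁻¹' A) (τ₀ ⁻¹' A))) l (𝓝 0)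
  measurableSet_empty := ⟨MeasurableSet.empty, by
    simpa using tendsto_const_nhds⟩
  measurableSet_compl A hA := ⟨hA.1.compl, by
    simpa only [Set.preimage_compl, compl_symmDiff_compl] using hA.2⟩
  measurableSet_iUnion A hA := by
    refine ⟨MeasurableSet.iUnion fun i => (hA i).1, ?_⟩
    rw [ENNReal.tendsto_nhds_zero]
    intro ε hε
    have hε4 : 0 < ε / 2 / 2 := ENNReal.half_pos (ENNReal.half_pos hε.ne').ne'
    -- Finite unions are handled termwise; the remainder has measure at most `ε / 4`, also after
    -- taking preimages, because the maps preserve `m`.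
    set V : ℕ → Set X := fun n => ⋃ i ∈ Finset.range n, A i with hV
    have hVm : ∀ n, MeasurableSet (V n) := fun n =>
      Finset.measurableSet_biUnion _ fun i _ => (hA i).1
    have hAm : MeasurableSet (⋃ i, A i) := MeasurableSet.iUnion fun i => (hA i).1
    have hVsub : ∀ n, V n ⊆ ⋃ i, A i := fun n => Set.iUnion₂_subset fun i _ => Set.subset_iUnion A i
    have hVmono : Monotone V := fun i j hij =>
      Set.biUnion_subset_biUnion_left (Finset.range_mono hij)
    have hVU : ⋃ n, V n = ⋃ i, A i := by
      refine Set.Subset.antisymm (Set.iUnion_subset hVsub) (Set.iUnion_subset fun i => ?_)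
      exact Set.subset_iUnion_of_subset (i + 1)
        (Set.subset_biUnion_of_mem (u := A) (Finset.mem_range.2 (Nat.lt_succ_self i)))
    have hlim : Tendsto (fun n => m ((⋃ i, A i) \ V n)) atTop (𝓝 0) := by
      have hanti : Antitone fun n => (⋃ i, A i) \ V n := fun i j hij =>
        Set.sdiff_subset_sdiff_right (hVmono hij)
      have := tendsto_measure_iInter_atTop (μ := m)
        (fun n => (hAm.diff (hVm n)).nullMeasurableSet) hanti ⟨0, measure_ne_top _ _⟩
      rwa [← Set.sdiff_iUnion, hVU, Set.sdiff_self, measure_empty] at this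
    obtain ⟨n, hn⟩ := ((ENNReal.tendsto_nhds_zero.1 hlim) _ hε4).exists
    have hsum : Tendsto (fun u => ∑ i ∈ Finset.range n, m (symmDiff (τ u ⁻¹' A i) (τ₀ ⁻¹' A i))) l
        (𝓝 0) := by
      simpa using tendsto_finsetSum (Finset.range n) fun i _ => (hA i).2
    filter_upwards [(ENNReal.tendsto_nhds_zero.1 hsum) _ (ENNReal.half_pos hε.ne')] with u hu
    have hcov : symmDiff (τ u ⁻¹' ⋃ i, A i) (τ₀ ⁻¹' ⋃ i, A i) ⊆
        (⋃ i ∈ Finset.range n, symmDiff (τ u ⁻¹' A i) (τ₀ ⁻¹' A i)) ∪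
          ((τ u ⁻¹' ((⋃ i, A i) \ V n)) ∪ (τ₀ ⁻¹' ((⋃ i, A i) \ V n))) := by
      intro x hx
      by_contra hnot
      rw [Set.mem_union, Set.mem_union, not_or, not_or] at hnot
      obtain ⟨h1, h2, h3⟩ := hnot
      simp only [Set.mem_iUnion, not_exists] at h1
      have hiff : ∀ i ∈ Finset.range n, (τ u x ∈ A i ↔ τ₀ x ∈ A i) := by
        intro i hi
        have := h1 i hi
        rw [Set.mem_symmDiff] at this
        simp only [Set.mem_preimage] at this
        tauto
      rcases hx with ⟨h4, h5⟩ | ⟨h4, h5⟩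
      · have h6 : τ u x ∈ V n := by
          by_contra h7
          exact h2 ⟨h4, h7⟩
        obtain ⟨i, hi, hx⟩ := Set.mem_iUnion₂.1 h6
        exact h5 (Set.mem_iUnion.2 ⟨i, (hiff i hi).1 hx⟩)
      · have h6 : τ₀ x ∈ V n := by
          by_contra h7
          exact h3 ⟨h4, h7⟩
        obtain ⟨i, hi, hx⟩ := Set.mem_iUnion₂.1 h6
        exact h5 (Set.mem_iUnion.2 ⟨i, (hiff i hi).2 hx⟩)
    calc _ ≤ ∑ i ∈ Finset.range n, m (symmDiff (τ u ⁻¹' A i) (τ₀ ⁻¹' A i))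
          + (m (τ u ⁻¹' ((⋃ i, A i) \ V n)) + m (τ₀ ⁻¹' ((⋃ i, A i) \ V n))) :=
          (measure_mono hcov).trans ((measure_union_le _ _).trans
            (add_le_add (measure_biUnion_finset_le _ _) (measure_union_le _ _)))
      _ ≤ ε / 2 + (ε / 2 / 2 + ε / 2 / 2) := by
          rw [(hτ u).measure_preimage (hAm.diff (hVm n)).nullMeasurableSet,
            hτ₀.measure_preimage (hAm.diff (hVm n)).nullMeasurableSet]
          gcongr
      _ = ε := by rw [ENNReal.add_halves, ENNReal.add_halves]

/-- It suffices to treat half-lines in one coordinate. Only countably many levels are atoms, so each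
half-line is a countable intersection of half-lines at non-atoms. -/
theorem tendsto_measure_symmDiff_preimage {m : Measure (ℕ → ℝ)} [IsProbabilityMeasure m]
    {l : Filter U} {τ : U → (ℕ → ℝ) → ℕ → ℝ} {τ₀ : (ℕ → ℝ) → ℕ → ℝ}
    (hτ : ∀ u, MeasurePreserving (τ u) m m) (hτ₀ : MeasurePreserving τ₀ m m)
    (h : ∀ k, TendstoInMeasure m (fun u x => τ u x k) l fun x => τ₀ x k)
    {A : Set (ℕ → ℝ)} (hA : MeasurableSet A) :
    Tendsto (fun u => m (symmDiff (τ u ⁻¹' A) (τ₀ ⁻¹' A))) l (𝓝 0) := by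
  have hle : MeasurableSpace.pi ≤ convergencePreimageSpace m l hτ hτ₀ := by
    refine iSup_le fun k => ?_
    rw [← measurable_iff_comap_le]
    refine @measurable_of_Iic ℝ _ _ _ _ (convergencePreimageSpace m l hτ hτ₀) _ _ _ _ fun a => ?_
    have hY₀ : Measurable fun x => τ₀ x k := (measurable_pi_apply k).comp hτ₀.measurable
    have hdense : Dense {t | 0 < m {x | τ₀ x k = t}}ᶜ :=
      (Measure.countable_meas_level_set_pos (μ := m) hY₀).dense_compl ℝ
    have hex : ∀ n : ℕ, ∃ b, m {x | τ₀ x k = b} = 0 ∧ a < b ∧ b < a + 1 / ((n : ℝ) + 1) := by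
      intro n
      obtain ⟨b, hb, hab⟩ := hdense.exists_between
        (lt_add_of_pos_right a (by positivity : 0 < 1 / ((n : ℝ) + 1)))
      exact ⟨b, by simpa using hb, hab.1, hab.2⟩
    choose b hb0 hab hba using hex
    have heq : (fun x : ℕ → ℝ => x k) ⁻¹' Set.Iic a = ⋂ n, (fun x => x k) ⁻¹' Set.Iic (b n) := by
      ext x
      simp only [Set.mem_preimage, Set.mem_Iic, Set.mem_iInter]
      refine ⟨fun hx n => hx.trans (hab n).le, fun hx => ?_⟩
      have hlim : Tendsto (fun n : ℕ => a + 1 / ((n : ℝ) + 1)) atTop (𝓝 a) := by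
        simpa using tendsto_one_div_add_atTop_nhds_zero_nat.const_add a
      exact ge_of_tendsto' hlim fun n => (hx n).trans (hba n).le
    rw [heq]
    refine @MeasurableSet.iInter _ _ (convergencePreimageSpace m l hτ hτ₀) _ _ fun n => ?_
    exact ⟨measurable_pi_apply k measurableSet_Iic,
      tendsto_measure_symmDiff_Iic hY₀ (h k) (hb0 n)⟩
  exact (hle A hA).2

end Continuity

/-- Pull back the Cantor topology along a Borel isomorphism; the σ-algebra, and with it every
measure, is unchanged. -/
theorem exists_compact_metrizable_borel_topology (X : Type*) [MeasurableSpace X]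
    [StandardBorelSpace X] (hX : ¬ Countable X) :
    ∃ (_ : TopologicalSpace X), CompactSpace X ∧ TopologicalSpace.MetrizableSpace X ∧
      BorelSpace X := by
  let e : X ≃ᵐ (ℕ → Bool) := PolishSpace.measurableEquivNatBoolOfNotCountable hX
  let _ : TopologicalSpace X := TopologicalSpace.induced e inferInstance
  let h : X ≃ₜ (ℕ → Bool) := e.toEquiv.toHomeomorphOfIsInducing ⟨rfl⟩
  refine ⟨inferInstance, h.symm.compactSpace, h.isEmbedding.metrizableSpace, ⟨?_⟩⟩
  refine e.measurableEmbedding.comap_eq.symm.trans ?_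
  exact (congrArg (MeasurableSpace.comap e) BorelSpace.measurable_eq).trans borel_comap.symm

/-- Homogeneity; where `A v = 0`, all multiples of `v` satisfy the hypothesis, so `B v = 0`. -/
theorem norm_le_of_norm_lt_imp {V E F : Type*} [AddCommGroup V] [Module ℝ V]
    [NormedAddCommGroup E] [NormedSpace ℝ E] [NormedAddCommGroup F] [NormedSpace ℝ F]
    (A : V →ₗ[ℝ] E) (B : V →ₗ[ℝ] F) {δ : ℝ} (hδ : 0 < δ) (h : ∀ v, ‖A v‖ < δ → ‖B v‖ < 1) (v : V) :
    ‖B v‖ ≤ 2 / δ * ‖A v‖ := by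
  rcases (norm_nonneg (A v)).eq_or_lt' with h0 | h0
  · rw [h0, mul_zero]
    by_contra! hpos
    have := h (‖B v‖⁻¹ • v) (by rw [map_smul, norm_smul, h0, mul_zero]; exact hδ)
    rw [map_smul, norm_smul, norm_inv, norm_norm, inv_mul_cancel₀ hpos.ne'] at this
    exact lt_irrefl _ this
  · have := h ((δ / 2 / ‖A v‖) • v) (by
      rw [map_smul, norm_smul, Real.norm_of_nonneg (by positivity), div_mul_cancel₀ _ h0.ne']
      exact half_lt_self hδ)
    rw [map_smul, norm_smul, Real.norm_of_nonneg (by positivity), div_mul_eq_mul_div,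
      div_lt_one h0] at this
    rw [div_mul_eq_mul_div, le_div_iff₀ hδ]
    linarith

/-! ### Functions generating the neighbourhoods of zero. -/

section Symmetry

variable {H : Type*} [NormedAddCommGroup H] [InnerProductSpace ℝ H] {f : H → ℂ}

theorem GeneratesNhdsZero.exists_norm_lt_one {H : Type*} [NormedAddCommGroup H] {f : H → ℂ}
    (hgen : GeneratesNhdsZero f) (hf0 : f 0 = 1) :
    ∃ ε > 0, ∀ ξ, ‖f ξ - 1‖ < ε → ‖ξ‖ < 1 := by
  obtain ⟨O, hO, h0, hsub⟩ := hgen (Metric.ball 0 1) (Metric.ball_mem_nhds 0 one_pos)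
  rw [hf0] at h0
  obtain ⟨ε, hε, hball⟩ := Metric.isOpen_iff.1 hO 1 h0
  refine ⟨ε, hε, fun ξ hξ => ?_⟩
  have : ξ ∈ Metric.ball (0 : H) 1 := hsub (hball (by rwa [Metric.mem_ball, dist_eq_norm]))
  simpa using this

/-- The group of all invertible operators that fix `f`. -/
def fullSymmetryGroup (f : H → ℂ) : Subgroup (H ≃L[ℝ] H) where
  carrier := {u | ∀ ξ, f (u ξ) = f ξ}
  mul_mem' {u v} hu hv ξ := (hu (v ξ)).trans (hv ξ)
  one_mem' _ := rfl
  inv_mem' {u} hu ξ := by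
    have := hu (u⁻¹ ξ)
    rw [← this]
    congr 1
    exact u.apply_symm_apply ξ

/-- For `‖v‖ < δ` the value `f (u v) = f v` is close to `1`, which forces `‖u v‖ < 1`, with `δ`
independent of `u`. -/
theorem GeneratesNhdsZero.isUniformlyBounded_fullSymmetryGroup (hgen : GeneratesNhdsZero f)
    (hf : IsNormalizedPosDef f) : IsUniformlyBoundedSymmetryGroup f (fullSymmetryGroup f) := by
  refine ⟨?_, fun u hu => hu⟩
  obtain ⟨ε, hε, hlt⟩ := hgen.exists_norm_lt_one hf.map_zero
  obtain ⟨δ, hδ, hcont⟩ := Metric.continuousAt_iff.1 (hf.continuous.continuousAt (x := 0)) ε hε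
  refine ⟨2 / δ, fun u hu => ContinuousLinearMap.opNorm_le_bound _ (by positivity) fun ξ => ?_⟩
  refine norm_le_of_norm_lt_imp LinearMap.id ((u : H →L[ℝ] H) : H →ₗ[ℝ] H) hδ (fun v hv => ?_) ξ
  refine hlt _ ?_
  have h1 := hcont (x := v) (by simpa using hv)
  rw [hf.map_zero, dist_eq_norm] at h1
  have h2 : f (u v) = f v := hu v
  change ‖f (u v) - 1‖ < ε
  rwa [h2]

variable {X : Type*} [MeasurableSpace X] {m : Measure X} [IsProbabilityMeasure m]

/-- If `T (ξ n) → 0`, a subsequence tends to `0` a.e., and so does its product with the possibly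
unbounded `φ`. Dominated convergence gives `f → 1` along it, so some `ξ n` has norm below `1`. -/
theorem Represents.isEmbedding {T : H →L[ℝ] Lp ℝ 2 m} {φ : X → ℝ} (hT : Represents f m T φ)
    (hf0 : f 0 = 1) (hgen : GeneratesNhdsZero f) : IsEmbedding T := by
  obtain ⟨ε, hε, hlt⟩ := hgen.exists_norm_lt_one hf0
  have hex : ∃ δ > 0, ∀ ξ, ‖T ξ‖ < δ → ‖ξ‖ < 1 := by
    by_contra! hno
    choose ξ hTξ hξ using fun n : ℕ => hno (1 / ((n : ℝ) + 1)) (by positivity)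
    have hlim : Tendsto (fun n => T (ξ n)) atTop (𝓝 0) :=
      squeeze_zero_norm (fun n => (hTξ n).le) tendsto_one_div_add_atTop_nhds_zero_nat
    obtain ⟨k, -, hk⟩ := (tendstoInMeasure_of_tendsto_Lp hlim).exists_seq_tendsto_ae
    have hflim : Tendsto (fun n => f (ξ (k n))) atTop (𝓝 1) := by
      simp_rw [hT.eq_integral]
      have h1 : ∫ x, (1 : ℂ) ∂m = 1 := by simp
      rw [← h1]
      have hφ := hT.measurable
      refine tendsto_integral_of_dominated_convergence (fun _ => 1) (fun n => ?_)
        (integrable_const _) (fun n => ?_) ?_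
      · have := (Lp.stronglyMeasurable (T (ξ (k n)))).measurable
        exact (by fun_prop : Measurable _).aestronglyMeasurable
      · refine ae_of_all _ fun x => ?_
        rw [mul_comm]
        exact (Complex.norm_exp_ofReal_mul_I _).le
      · filter_upwards [hk, Lp.coeFn_zero ℝ 2 m] with x hx h0
        rw [h0] at hx
        have hc : Continuous fun y : ℝ => Complex.exp (Complex.I * (y : ℂ)) := by fun_prop
        have := (hc.tendsto (φ x * 0)).comp (hx.const_mul (φ x))
        simpa [Function.comp_def] using this
    obtain ⟨n, hn⟩ := (Metric.tendsto_nhds.1 hflim ε hε).exists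
    rw [dist_eq_norm] at hn
    exact absurd (hlt _ hn) (not_lt.2 (hξ _))
  obtain ⟨δ, hδ, h⟩ := hex
  have hanti : AntilipschitzWith (Real.toNNReal (2 / δ)) T :=
    AddMonoidHomClass.antilipschitz_of_bound T fun ξ => by
      rw [Real.coe_toNNReal _ (by positivity)]
      exact norm_le_of_norm_lt_imp T.toLinearMap LinearMap.id hδ h ξ
  exact (hanti.isUniformEmbedding T.uniformContinuous).isEmbedding

end Symmetry

/-! ### Automorphism classes and the weighted operator. -/

namespace MPEquiv

variable {X : Type*} [MeasurableSpace X] {m : Measure X}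

theorem mk_eq_mk_iff {s t : MPEquiv m} :
    (QuotientGroup.mk s : MPAut m) = QuotientGroup.mk t ↔ s.1 =ᵐ[m] t.1 := by
  rw [QuotientGroup.eq]
  change (∀ᵐ x ∂m, s.1.symm (t.1 x) = x) ↔ _
  refine eventually_congr (Eventually.of_forall fun x => ?_)
  rw [MeasurableEquiv.symm_apply_eq, eq_comm]

theorem symm_ae_eq {s t : MPEquiv m} (h : s.1 =ᵐ[m] t.1) : s.1.symm =ᵐ[m] t.1.symm := by
  filter_upwards [(s.2.symm s.1).quasiMeasurePreserving.ae h] with x hx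
  rw [MeasurableEquiv.apply_symm_apply] at hx
  rw [← MeasurableEquiv.symm_apply_eq] at hx
  exact hx.symm

theorem continuous_of_tendsto {U : Type*} [TopologicalSpace U] {b : U → MPEquiv m}
    (h : ∀ (u₀ : U) (A : Set X), MeasurableSet A →
      Tendsto (fun u => m (symmDiff ((b u).1 '' A) ((b u₀).1 '' A))) (𝓝 u₀) (𝓝 0)) :
    Continuous b := by
  refine continuous_generateFrom_iff.2 ?_
  rintro _ ⟨s, A, ε, hA, -, rfl⟩
  refine isOpen_iff_mem_nhds.2 fun u₀ hu₀ => ?_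
  have hu₀' : m (symmDiff ((b u₀).1 '' A) (s.1 '' A)) < ε := hu₀
  filter_upwards [(h u₀ A hA).eventually (gt_mem_nhds (tsub_pos_of_lt hu₀'))] with u hu
  exact (measure_symmDiff_le _ _ _).trans_lt (lt_tsub_iff_right.1 hu)

end MPEquiv

theorem IsLinearProcess.exists_weighted_operator {H X : Type*} [NormedAddCommGroup H]
    [NormedSpace ℝ H] [MeasurableSpace X] {f : H → ℂ} {m : Measure X} [IsProbabilityMeasure m]
    {L : H → X → ℝ} (hL : IsLinearProcess f m L) (hf0 : f 0 = 1) {s : X → ℝ} (hs : Measurable s)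
    {C : ℝ} (hC : 0 < C)
    (hB : ∀ ξ, C * ‖ξ‖ ≤ 1 → ∫⁻ x, ENNReal.ofReal ((s x * L ξ x) ^ 2) ∂m ≤ 1) :
    ∃ T : H →L[ℝ] Lp ℝ 2 m, ∀ ξ, T ξ =ᵐ[m] fun x => s x * L ξ x := by
  have hm := hL.measurable
  have hint : ∀ ξ, C * ‖ξ‖ ≤ 1 → Integrable (fun x => (s x * L ξ x) ^ 2) m := by
    intro ξ hξ
    refine (lintegral_ofReal_ne_top_iff_integrable (by fun_prop : Measurable _).aestronglyMeasurable
      (ae_of_all _ fun x => sq_nonneg _)).1 (ne_top_of_le_ne_top ENNReal.one_ne_top (hB ξ hξ))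
  have hmem₁ : ∀ ξ, C * ‖ξ‖ ≤ 1 → MemLp (fun x => s x * L ξ x) 2 m := fun ξ hξ =>
    (memLp_two_iff_integrable_sq (by fun_prop : Measurable _).aestronglyMeasurable).2 (hint ξ hξ)
  have hmem : ∀ ξ, MemLp (fun x => s x * L ξ x) 2 m := by
    intro ξ
    have hc : 0 < C * (‖ξ‖ + 1) := by positivity
    have h1 := hmem₁ ((C * (‖ξ‖ + 1))⁻¹ • ξ) (by
      rw [norm_smul, norm_inv, Real.norm_of_nonneg hc.le]
      rw [mul_inv, ← mul_assoc, ← mul_assoc, mul_inv_cancel₀ hC.ne', one_mul, inv_mul_le_iff₀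
        (by positivity)]
      linarith)
    refine (memLp_congr_ae ?_).1 (h1.const_mul (C * (‖ξ‖ + 1)))
    filter_upwards [hL.map_smul hf0 (C * (‖ξ‖ + 1))⁻¹ ξ] with x hx
    rw [hx]
    field_simp
  let T₀ : H →ₗ[ℝ] Lp ℝ 2 m :=
    { toFun := fun ξ => (hmem ξ).toLp
      map_add' := fun ξ η => by
        rw [← MemLp.toLp_add, MemLp.toLp_eq_toLp_iff]
        filter_upwards [hL.map_add hf0 ξ η] with x hx
        rw [hx, Pi.add_apply, mul_add]
      map_smul' := fun c ξ => by
        rw [RingHom.id_apply, ← MemLp.toLp_const_smul, MemLp.toLp_eq_toLp_iff]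
        filter_upwards [hL.map_smul hf0 c ξ] with x hx
        rw [hx, Pi.smul_apply, smul_eq_mul]
        ring }
  -- The factor `2⁻¹` turns the bound `‖T₀ ξ‖ ≤ 1` into the strict one required by
  -- `norm_le_of_norm_lt_imp`.
  have hnorm : ∀ ξ, ‖ξ‖ < C⁻¹ / 2 → ‖(2⁻¹ : ℝ) • T₀ ξ‖ < 1 := by
    intro ξ hξ
    have hCξ : C * ‖ξ‖ ≤ 1 := by
      have : C * ‖ξ‖ ≤ C * C⁻¹ := by
        gcongr
        have := inv_pos.2 hC
        linarith
      rwa [mul_inv_cancel₀ hC.ne'] at this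
    have h1 : ‖T₀ ξ‖ ^ 2 = ∫ x, (s x * L ξ x) ^ 2 ∂m := by
      rw [← real_inner_self_eq_norm_sq, L2.inner_def]
      refine integral_congr_ae ?_
      filter_upwards [(hmem ξ).coeFn_toLp] with x hx
      change inner ℝ ((hmem ξ).toLp _ x) ((hmem ξ).toLp _ x) = _
      rw [hx, real_inner_self_eq_norm_sq, Real.norm_eq_abs, sq_abs]
    have h2 : ∫ x, (s x * L ξ x) ^ 2 ∂m ≤ 1 := by
      rw [← ENNReal.ofReal_le_one, ofReal_integral_eq_lintegral_ofReal (hint ξ hCξ)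
        (ae_of_all _ fun x => sq_nonneg _)]
      exact hB ξ hCξ
    rw [← h1] at h2
    have h3 : ‖T₀ ξ‖ ≤ 1 := (sq_le_one_iff₀ (norm_nonneg _)).1 h2
    rw [norm_smul, norm_inv, Real.norm_ofNat]
    linarith
  refine ⟨T₀.mkContinuous (2 * (2 / (C⁻¹ / 2))) fun ξ => ?_, fun ξ => (hmem ξ).coeFn_toLp⟩
  have := norm_le_of_norm_lt_imp LinearMap.id ((2⁻¹ : ℝ) • T₀) (by positivity) hnorm ξ
  rw [LinearMap.smul_apply, norm_smul, norm_inv, Real.norm_ofNat, LinearMap.id_apply] at this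
  linarith

theorem not_countable_coord_ne_zero : ¬ {x : ℕ → ℝ | x 0 ≠ 0}.Countable := by
  intro hc
  have hinj : Function.Injective fun (r : ℝ) (k : ℕ) => if k = 0 then (1 : ℝ) else r := by
    intro r r' h
    simpa using congrFun h 1
  have h1 := hc.preimage hinj
  refine Cardinal.not_countable_real (h1.mono fun r _ => ?_)
  simp

/-! ### Equivariant representations on the sequence space. -/

section SequenceModel

variable {H : Type*} [NormedAddCommGroup H] [InnerProductSpace ℝ H] {f : H → ℂ} {d : ℕ → H}
  {m : Measure (ℕ → ℝ)} [IsProbabilityMeasure m] {L : H → (ℕ → ℝ) → ℝ}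

/-- Starting the dense sequence at `0` provides an uncountable null set, the room needed to complete
a.e. inverses to Borel automorphisms. -/
theorem HasSequenceLaw.measure_coord_ne_zero (h : HasSequenceLaw f d m) (hf0 : f 0 = 1)
    (hd : d 0 = 0) : m {x | x 0 ≠ 0} = 0 := by
  refine measure_eq_zero_iff_ae_notMem.2 ?_
  have h0 := ae_eq_zero_of_integral_exp_eq_one (m := m) (Y := fun x => x 0)
    (measurable_pi_apply 0) fun s => by
      have := h {0} fun _ => s
      simpa [hd, hf0] using this
  filter_upwards [h0] with x hx hne
  exact hne hx

theorem exists_mpEquiv_coordMap (hL : ∀ ξ, IsCoordLimit d m ξ (L ξ)) (h : HasSequenceLaw f d m)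
    (hf : IsNormalizedPosDef f) (hd : d 0 = 0) (u : H ≃L[ℝ] H) (hu : ∀ ξ, f (u ξ) = f ξ) :
    ∃ t : MPEquiv m, t.1 =ᵐ[m] coordMap L d u.symm ∧ t.1.symm =ᵐ[m] coordMap L d u := by
  have hu' : ∀ ξ, f (u.symm ξ) = f ξ := fun ξ => by
    rw [← hu (u.symm ξ), u.apply_symm_apply]
  have hid := coordMap_id hL h hf
  refine exists_mpEquiv_of_ae_inverse
    (measurePreserving_coordMap hL h hf (u.symm : H →L[ℝ] H) hu')
    (measurePreserving_coordMap hL h hf (u : H →L[ℝ] H) hu) ?_ ?_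
    (measurableSet_eq_fun (measurable_pi_apply 0) measurable_const).compl
    (h.measure_coord_ne_zero hf.map_zero hd) not_countable_coord_ne_zero
  · filter_upwards [coordMap_comp hL h hf u (u.symm : H →L[ℝ] H) hu', hid] with x h1 h2
    refine h1.trans (Eq.trans ?_ h2)
    congr 1
    ext ξ
    exact u.symm_apply_apply ξ
  · filter_upwards [coordMap_comp hL h hf u.symm (u : H →L[ℝ] H) hu, hid] with x h1 h2
    refine h1.trans (Eq.trans ?_ h2)
    congr 1
    ext ξ
    exact u.apply_symm_apply ξ

/-- Operators of the form `s * L` are equivariant as soon as the weight `s` is invariant. -/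
theorem isEquivariantFor_of_weight (hL : ∀ ξ, IsCoordLimit d m ξ (L ξ))
    (h : HasSequenceLaw f d m) (hf : IsNormalizedPosDef f) (hd : d 0 = 0)
    {𝒢 : Subgroup (H ≃L[ℝ] H)} (h𝒢 : ∀ u ∈ 𝒢, ∀ ξ, f (u ξ) = f ξ)
    {T : H →L[ℝ] Lp ℝ 2 m} {s : (ℕ → ℝ) → ℝ} (hT : ∀ ξ, T ξ =ᵐ[m] fun x => s x * L ξ x)
    (hs : ∀ u ∈ 𝒢, (fun x => s (coordMap L d u x)) =ᵐ[m] s) :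
    IsEquivariantFor T (fun x => (s x)⁻¹) 𝒢 := by
  have hP := IsCoordLimit.isLinearProcess h hf.continuous hL
  have hτ : ∀ u ∈ 𝒢, MeasurePreserving (coordMap L d u) m m := fun u hu =>
    measurePreserving_coordMap hL h hf (u : H →L[ℝ] H) (h𝒢 u hu)
  choose b hb hb' using fun u : 𝒢 =>
    exists_mpEquiv_coordMap hL h hf hd (u : H ≃L[ℝ] H) (h𝒢 u u.2)
  -- `coordMap` reverses composition and `b u` is built from the inverse of `u`; the two reversals
  -- cancel.
  have hmul : ∀ u v : 𝒢, (QuotientGroup.mk (b (u * v)) : MPAut m)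
      = QuotientGroup.mk (b u) * QuotientGroup.mk (b v) := by
    intro u v
    rw [← QuotientGroup.mk_mul, MPEquiv.mk_eq_mk_iff]
    have h1 := coordMap_comp hL h hf ((u : H ≃L[ℝ] H).symm)
      ((v : H ≃L[ℝ] H).symm : H →L[ℝ] H) (h𝒢 _ (𝒢.inv_mem v.2))
    filter_upwards [hb (u * v), hb v, (b v).2.quasiMeasurePreserving.ae (hb u), h1]
      with x e1 e2 e3 e4
    change (b (u * v)).1 x = (b u).1 ((b v).1 x)
    rw [e1, e3, e2]
    exact e4.symm
  refine ⟨MonoidHom.mk' (fun u => (QuotientGroup.mk (b u) : MPAut m)) hmul, ?_, fun u t ht => ?_⟩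
  · let _ := strongOperatorTopology 𝒢
    have heval : ∀ ξ : H, Continuous fun u : 𝒢 => (u : H ≃L[ℝ] H) ξ := fun ξ =>
      (continuous_apply ξ).comp continuous_induced_dom
    have hbc : Continuous b := by
      refine MPEquiv.continuous_of_tendsto fun u₀ A hA => ?_
      have h1 := tendsto_measure_symmDiff_preimage (m := m) (l := 𝓝 u₀)
        (τ := fun u : 𝒢 => coordMap L d (u : H ≃L[ℝ] H))
        (τ₀ := coordMap L d (u₀ : H ≃L[ℝ] H)) (fun u => hτ u u.2) (hτ u₀ u₀.2)
        (fun k => hP.tendstoInMeasure hf ((heval (d k)).tendsto u₀)) hA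
      refine h1.congr fun u => measure_congr ?_
      have himg : ∀ u : 𝒢, (b u).1 '' A =ᵐ[m] coordMap L d (u : H ≃L[ℝ] H) ⁻¹' A := by
        intro u
        rw [(b u).1.image_eq_preimage_symm]
        filter_upwards [hb' u] with x hx
        exact congrArg (· ∈ A) hx
      exact ((himg u).symmDiff (himg u₀)).symm
    exact continuous_quotient_mk'.comp hbc
  · have ht' : t.1 =ᵐ[m] (b u).1 := MPEquiv.mk_eq_mk_iff.1 ht
    have ht1 : t.1 =ᵐ[m] coordMap L d (u : H ≃L[ℝ] H).symm := ht'.trans (hb u)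
    have ht2 : t.1.symm =ᵐ[m] coordMap L d (u : H ≃L[ℝ] H) :=
      (MPEquiv.symm_ae_eq ht').trans (hb' u)
    refine ⟨fun ξ => ?_, ?_⟩
    · filter_upwards [ht2, hT ((u : H ≃L[ℝ] H) ξ), hs u u.2,
        (hτ u u.2).quasiMeasurePreserving.ae (hT ξ),
        comp_coordMap hL h hf ((u : H ≃L[ℝ] H) : H →L[ℝ] H) (h𝒢 u u.2) ξ] with x e1 e2 e3 e4 e5
      rw [e1, e2, e4, e3]
      congr 1
      exact e5.symm
    · filter_upwards [ht1, hs _ (𝒢.inv_mem u.2)] with x e1 e2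
      rw [e1]
      exact congrArg _ e2

/-- The constraints on the weight run over the `𝒢`-invariant set `B`, so the canonical weight is
invariant. Allowing subgroups `𝒢'` with the same `T` and `φ` lets the full symmetry group serve all
groups at once. -/
theorem exists_represents_isEquivariantFor (hL : ∀ ξ, IsCoordLimit d m ξ (L ξ))
    (h : HasSequenceLaw f d m) (hf : IsNormalizedPosDef f) (hd : d 0 = 0)
    {𝒢 : Subgroup (H ≃L[ℝ] H)} (h𝒢 : IsUniformlyBoundedSymmetryGroup f 𝒢) :
    ∃ (T : H →L[ℝ] Lp ℝ 2 m) (φ : (ℕ → ℝ) → ℝ), Represents f m T φ ∧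
      ∀ 𝒢' ≤ 𝒢, IsEquivariantFor T φ 𝒢' := by
  have hP := IsCoordLimit.isLinearProcess h hf.continuous hL
  have hm := hP.measurable
  obtain ⟨C₀, hC₀⟩ := h𝒢.bounded
  set B : Set H := {ξ | ∀ u ∈ 𝒢, ‖u ξ‖ ≤ 1} with hB
  have hmeas : ∀ k ∈ L '' B, Measurable k := by
    rintro _ ⟨ξ, -, rfl⟩
    exact hm ξ
  obtain ⟨s, hs, hspos, hsuniq⟩ := exists_canonical_weight (m := m) hmeas fun E hE hmE =>
    hP.exists_admissibleWeight hf (B := B) (fun ξ hξ => hξ 1 𝒢.one_mem) hE hmE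
  have hτ : ∀ u ∈ 𝒢, MeasurePreserving (coordMap L d u) m m := fun u hu =>
    measurePreserving_coordMap hL h hf (u : H →L[ℝ] H) (h𝒢.map_eq u hu)
  have hinv : ∀ u ∈ 𝒢, (fun x => s (coordMap L d u x)) =ᵐ[m] s := by
    intro u hu
    have hsm := hs.measurable
    -- The transported weight is admissible because `B` is invariant, and equally far from `1`
    -- because `m` is preserved; uniqueness applies.
    refine hsuniq _ ⟨hsm.comp (hτ u hu).measurable, fun x => hs.nonneg _, fun x => hs.le_one _, ?_⟩ ?_
    · rintro _ ⟨ξ, hξ, rfl⟩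
      have hη : u.symm ξ ∈ B := fun v hv => hξ (v * u⁻¹) (𝒢.mul_mem hv (𝒢.inv_mem hu))
      refine le_trans (le_of_eq ?_) (hs.lintegral_le _ ⟨_, hη, rfl⟩)
      rw [← (hτ u hu).lintegral_comp (f := fun x => ENNReal.ofReal ((s x * L (u.symm ξ) x) ^ 2))
        (by fun_prop)]
      refine lintegral_congr_ae ?_
      filter_upwards [comp_coordMap hL h hf (u : H →L[ℝ] H) (h𝒢.map_eq u hu) (u.symm ξ)] with x hx
      have hx' : L (u.symm ξ) (coordMap L d u x) = L ξ x := by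
        refine hx.trans ?_
        congr 1
        exact u.apply_symm_apply ξ
      rw [hx']
    · have hsm2 : StronglyMeasurable fun x => (1 - s x) ^ 2 :=
        (by fun_prop : Measurable _).stronglyMeasurable
      rw [← integral_map (φ := coordMap L d u) (f := fun x => (1 - s x) ^ 2)
        (hτ u hu).measurable.aemeasurable hsm2.aestronglyMeasurable, (hτ u hu).map_eq]
  -- A change on a null set, so that `φ = 1 / s'` is positive everywhere.
  set s' : (ℕ → ℝ) → ℝ := fun x => if 0 < s x then s x else 1 with hs'
  have hs'm : Measurable s' :=
    Measurable.ite (measurableSet_lt measurable_const hs.measurable) hs.measurable measurable_const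
  have hs'pos : ∀ x, 0 < s' x := by
    intro x
    by_cases hx : 0 < s x <;> simp [s', hx]
  have hss' : s' =ᵐ[m] s := by
    filter_upwards [hspos] with x hx
    simp [s', hx]
  have hinv' : ∀ u ∈ 𝒢, (fun x => s' (coordMap L d u x)) =ᵐ[m] s' := by
    intro u hu
    filter_upwards [hinv u hu, hss', (hτ u hu).quasiMeasurePreserving.ae hss'] with x e1 e2 e3
    rw [e3, e1, e2]
  have hC : 0 < max C₀ 1 := by positivity
  obtain ⟨T, hT⟩ := hP.exists_weighted_operator hf.map_zero hs'm hC fun ξ hξ => by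
    have hξB : ξ ∈ B := fun u hu => by
      refine (((u : H →L[ℝ] H).le_opNorm ξ).trans ?_).trans hξ
      gcongr
      exact (hC₀ u hu).trans (le_max_left _ _)
    refine (lintegral_congr_ae ?_).trans_le (hs.lintegral_le _ ⟨ξ, hξB, rfl⟩)
    filter_upwards [hss'] with x hx
    rw [hx]
  refine ⟨T, fun x => (s' x)⁻¹, ⟨hs'm.inv, fun x => inv_pos.2 (hs'pos x), fun ξ => ?_⟩,
    fun 𝒢' hle => isEquivariantFor_of_weight hL h hf hd
      (fun u hu => h𝒢.map_eq u (hle hu)) hT fun u hu => hinv' u (hle hu)⟩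
  have h1 := hP.law_single ξ 1
  rw [one_smul] at h1
  rw [← h1]
  refine integral_congr_ae ?_
  filter_upwards [hT ξ] with x hx
  rw [hx, inv_mul_cancel_left₀ (hs'pos x).ne', one_mul, mul_comm]

end SequenceModel

theorem not_countable_sequence : ¬ Countable (ℕ → ℝ) := fun _ =>
  not_countable_coord_ne_zero (Set.to_countable _)

theorem exists_dense_sequence_zero (H : Type*) [NormedAddCommGroup H]
    [TopologicalSpace.SeparableSpace H] : ∃ d : ℕ → H, d 0 = 0 ∧ DenseRange d := by
  refine ⟨fun n => Nat.casesOn n 0 (TopologicalSpace.denseSeq H), rfl, ?_⟩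
  refine (TopologicalSpace.denseRange_denseSeq H).mono ?_
  rintro _ ⟨n, rfl⟩
  exact ⟨n + 1, rfl⟩

theorem mainTheorem4 {H : Type*} [NormedAddCommGroup H] [InnerProductSpace ℝ H] [CompleteSpace H]
    [TopologicalSpace.SeparableSpace H] (f : H → ℂ) (hf : IsNormalizedPosDef f) :
    ∃ (X : Type) (_ : TopologicalSpace X) (_ : CompactSpace X)
      (_ : TopologicalSpace.MetrizableSpace X) (_ : MeasurableSpace X) (_ : BorelSpace X)
      (m : Measure X) (_ : IsProbabilityMeasure m),
      (∃ (T : H →L[ℝ] Lp ℝ 2 m) (φ : X → ℝ), Represents f m T φ) ∧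
      (GeneratesNhdsZero f →
        ∃ (T : H →L[ℝ] Lp ℝ 2 m) (φ : X → ℝ), Represents f m T φ ∧ IsEmbedding T ∧
          ∀ 𝒢 : Subgroup (H ≃L[ℝ] H), IsUniformlyBoundedSymmetryGroup f 𝒢 →
            IsEquivariantFor T φ 𝒢) ∧
      (∀ 𝒢 : Subgroup (H ≃L[ℝ] H), IsUniformlyBoundedSymmetryGroup f 𝒢 →
        ∃ (T : H →L[ℝ] Lp ℝ 2 m) (φ : X → ℝ), Represents f m T φ ∧ IsEquivariantFor T φ 𝒢) := by
  obtain ⟨d, hd0, hd⟩ := exists_dense_sequence_zero H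
  obtain ⟨μ, hμ⟩ := exists_sequence_law hf d
  have hlaw : HasSequenceLaw f d (μ : Measure (ℕ → ℝ)) := hμ
  choose L hL using hlaw.exists_coordLimit hf hd
  obtain ⟨τ, hcompact, hmetr, hborel⟩ :=
    exists_compact_metrizable_borel_topology (ℕ → ℝ) not_countable_sequence
  have main := fun 𝒢 h𝒢 =>
    exists_represents_isEquivariantFor (𝒢 := 𝒢) hL hlaw hf hd0 h𝒢
  -- The trivial group yields the representation without symmetries.
  have hbot : IsUniformlyBoundedSymmetryGroup f (⊥ : Subgroup (H ≃L[ℝ] H)) := by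
    refine ⟨⟨‖((1 : H ≃L[ℝ] H) : H →L[ℝ] H)‖, fun u hu => ?_⟩, fun u hu ξ => ?_⟩
    · rw [Subgroup.mem_bot.1 hu]
    · rw [Subgroup.mem_bot.1 hu]; rfl
  refine ⟨ℕ → ℝ, τ, hcompact, hmetr, MeasurableSpace.pi, hborel, μ, inferInstance, ?_, ?_, ?_⟩
  · obtain ⟨T, φ, hT, -⟩ := main ⊥ hbot
    exact ⟨T, φ, hT⟩
  · intro hgen
    obtain ⟨T, φ, hT, heq⟩ := main _ (hgen.isUniformlyBounded_fullSymmetryGroup hf)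
    exact ⟨T, φ, hT, hT.isEmbedding hf.map_zero hgen, fun 𝒢 h𝒢 => heq 𝒢 h𝒢.map_eq⟩
  · intro 𝒢 h𝒢
    obtain ⟨T, φ, hT, heq⟩ := main 𝒢 h𝒢
    exact ⟨T, φ, hT, heq 𝒢 le_rfl⟩
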